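/- **Setting.** Let $M$ be a nonempty compact smooth boundaryless manifold of dimension $d\ge 0$ with a smooth Riemannian metric, induced distance $\mathrm{dist}$ and normalized Riemannian volume $m$, and let $f:M\to M$ be a $C^1$ diffeomorphism. Let $B_1\subset\mathbb R^n$ be the open unit ball and $F:M\times B_1\to M$, $F(x,t)=f_t(x)$, a $C^1$ map such that every $f_t$ is a diffeomorphism. For $0<\varepsilon<1$ let $\nu_\varepsilon$ be normalized Lebesgue measure on $\{t\in\mathbb R^n:\|t\|\le\varepsilon\}$, let $\Delta_\varepsilon$ be the set of sequences $\underline t=(t_j)_{j\ge1}$ with $\|t_j\|\le\varepsilon$ for all $j$, let $\nu_\varepsilon^\infty$ be the product measure on $\Delta_\varepsilon$, and put $f^j(x,\underline t)=f_{t_j}\circ\cdots\circ f_{t_1}(x)$, $f^0(x,\underline t)=x$. The family $F$ is a *physical random perturbation* of $f$, with threshold $\varepsilon_0\in(0,1)$, if $f_0=f$ and for every $\varepsilon\in(0,\varepsilon_0)$ there are $K\in\mathbb N$ and $\xi>0$ such that for all $x\in M$ and $j\ge K$: $f^j(x,\Delta_\varepsilon)\supset B(f^j(x),\xi)$, and the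 push-forward of $\nu^\infty_\varepsilon$ by $f^j(x,\cdot)$ is absolutely continuous with respect to $m$. An *attractor* is a compact set $\Lambda$ with $f(\Lambda)=\Lambda$, with a neighborhood $U$ such that $f(\overline U)\subset U$ and $\Lambda=\bigcap_{k\ge1}f^k(\overline U)$, and with a point $x\in\Lambda$ such that $\overline{\{f^k(x):k\ge1\}}=\Lambda$; its *basin* is $W^s(\Lambda)=\{x:\mathrm{dist}(f^k(x),\Lambda)\to0\}$. The *local physical measure* $\mu^\varepsilon_\Lambda$ of an attractor $\Lambda$ at level $\varepsilon$ is the probability measure $\mu$ (unique if it exists, and existing for all small $\varepsilon>0$) for which there is an open set $U$ with $f_t(\overline U)\subset U$ for all $\|t\|\le\varepsilon$, with $\Lambda\subset\operatorname{supp}\mu\subset U$, and such that for every $x\in U$ and $\nu_\varepsilon^\infty$-a.e. $\underline t$ one has $$\lim_{k\to\infty}\frac1k\sum_{j=0}^{k-1}\varphi(f^j(x,\underline t))=\int\varphi\,d\mu\quad\text{for all continuous }\varphi:M\to\mathbb R.\qquad(*)$$ The pair $(\Lambda,\mu)$ is *stochastically stable* with respect to $F$ if $\mu$ is an $f$-invariant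 probability measure with $\operatorname{supp}\mu=\Lambda$ and $\mu^\varepsilon_\Lambda\to\mu$ weak\* as $\varepsilon\to0^+$. A probability measure $\mu$ is *physical* at level $\varepsilon$ if the set of $x$ for which $(*)$ holds for $\nu_\varepsilon^\infty$-a.e. $\underline t$ has positive $m$-measure. The *mean sojourn time* $\mu^\varepsilon(x)$ of $x$ is the weak\* limit as $k\to\infty$ (if it exists) of the measures $A\mapsto\frac1k\sum_{j=0}^{k-1}\nu_\varepsilon^\infty\{\underline t:f^j(x,\underline t)\in A\}$, and the *global mean sojourn time* $\mu^\varepsilon$ is the weak\* limit (if it exists) of $A\mapsto\frac1k\sum_{j=0}^{k-1}(m\times\nu_\varepsilon^\infty)\{(x,\underline t):f^j(x,\underline t)\in A\}$. **Theorem A.** Let $F$ be a physical random perturbation of $f$ with threshold $\varepsilon_0$, and let $(\Lambda_i)_i$ be an at most countable family of pairwise disjoint attractors of $f$ whose basins $W^s(\Lambda_i)$ cover $m$-almost every point of $M$, each $\Lambda_i$ supporting an invariant probability measure $\mu_i$ such that $(\Lambda_i,\mu_i)$ is stochastically stable with respect to $F$. Write $\mu_i^\varepsilon=\mu^\varepsilon_{\Lambda_i}$.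 Then: 1. For $m$-almost every $x\in M$ there are $\varepsilon_x>0$ and an index $i=i(x)$ such that for every $\varepsilon\in(0,\varepsilon_x)$ the measure $\mu_i^\varepsilon$ and the mean sojourn time $\mu^\varepsilon(x)$ exist and $\mu^\varepsilon(x)=\mu_i^\varepsilon$; moreover $\mu^\varepsilon(x)\to\mu_i$ weak\* as $\varepsilon\to0^+$. 2. For every $\varepsilon\in(0,\varepsilon_0)$ there are only finitely many physical measures $\nu^\varepsilon_1,\dots,\nu^\varepsilon_l$ at level $\varepsilon$, $l=l(\varepsilon)$, the global mean sojourn time $\mu^\varepsilon$ exists, and $\mu^\varepsilon=\beta_1^\varepsilon\nu_1^\varepsilon+\cdots+\beta_l^\varepsilon\nu_l^\varepsilon$ for some $\beta_k^\varepsilon\ge0$ with $\beta_1^\varepsilon+\cdots+\beta_l^\varepsilon=1$. Moreover $\mu^\varepsilon\to\sum_i m(W^s(\Lambda_i))\,\mu_i$ weak\* as $\varepsilon\to0^+$. -/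

import Mathlib

open Set Filter Topology MeasureTheory Bundle
open scoped Manifold ContDiff ENNReal NNReal

namespace RandomPerturbation

/-! ### The normalized Riemannian volume -/

section Volume

variable (d : ℕ) (M : Type*) [TopologicalSpace M] [ChartedSpace (EuclideanSpace ℝ (Fin d)) M]
  [RiemannianBundle (fun x : M => TangentSpace (𝓡 d) x)]

variable {M} in
/-- The Gram matrix `(⟨∂ᵢ, ∂ⱼ⟩)` of the coordinate vector fields of the preferred chart at `c`,
at the point of `M` with coordinates `z`. -/
noncomputable def chartGram (c : M) (z : EuclideanSpace ℝ (Fin d)) : Matrix (Fin d) (Fin d) ℝ :=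
  fun i j =>
    inner ℝ
      (mfderiv 𝓘(ℝ, EuclideanSpace ℝ (Fin d)) (𝓡 d) (extChartAt (𝓡 d) c).symm z
        (EuclideanSpace.single i (1 : ℝ)))
      (mfderiv 𝓘(ℝ, EuclideanSpace ℝ (Fin d)) (𝓡 d) (extChartAt (𝓡 d) c).symm z
        (EuclideanSpace.single j (1 : ℝ)))

variable {M} in
/-- The measure `√(det g) dz` of the preferred chart at `c`, transported to `M`. It is the
restriction of the Riemannian volume to the domain of that chart. -/
noncomputable def chartVolume [MeasurableSpace M] (c : M) : Measure M :=
  ((volume.restrict (extChartAt (𝓡 d) c).target).withDensity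
    (fun z => ENNReal.ofReal (Real.sqrt (chartGram d c z).det))).map (extChartAt (𝓡 d) c).symm

/-- The Riemannian volume: the smallest measure dominating `√(det g) dz` in every chart. As these
local measures agree on overlaps, it is the measure obtained by glueing them. -/
noncomputable def riemannianVolume [MeasurableSpace M] : Measure M :=
  ⨆ c : M, chartVolume d c

/-- The Riemannian volume, normalized to total mass one. -/
noncomputable def normalizedVolume [MeasurableSpace M] : Measure M :=
  (riemannianVolume d M Set.univ)⁻¹ • riemannianVolume d M

end Volume

/-! ### Random orbits -/

section Orbits

variable {M : Type*} {n : ℕ}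

/-- The perturbed iterate `f_{t_j} ∘ ⋯ ∘ f_{t_1} (x)`. The sequence `t` is indexed from `0`, so
that `t_j` of the usual notation is `t (j - 1)`. -/
def iter (F : M → EuclideanSpace ℝ (Fin n) → M) (t : ℕ → EuclideanSpace ℝ (Fin n)) :
    ℕ → M → M
  | 0, x => x
  | j + 1, x => F (iter F t j x) (t j)

/-- The perturbation space: all sequences in the closed ball of radius `ε`. -/
def perturbationSpace (n : ℕ) (ε : ℝ) : Set (ℕ → EuclideanSpace ℝ (Fin n)) :=
  {t | ∀ j, ‖t j‖ ≤ ε}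

/-- The normalized Lebesgue measure of the closed ball of radius `ε`. -/
noncomputable def noise (n : ℕ) (ε : ℝ) : Measure (EuclideanSpace ℝ (Fin n)) :=
  (volume (Metric.closedBall (0 : EuclideanSpace ℝ (Fin n)) ε))⁻¹ •
    volume.restrict (Metric.closedBall (0 : EuclideanSpace ℝ (Fin n)) ε)

/-- For `ε > 0` the noise is a probability measure (so that its infinite power is meaningful). -/
theorem isProbabilityMeasure_noise (n : ℕ) {ε : ℝ} (hε : 0 < ε) :
    IsProbabilityMeasure (noise n ε) := by
  refine ⟨?_⟩
  have h0 : volume (Metric.closedBall (0 : EuclideanSpace ℝ (Fin n)) ε) ≠ 0 :=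
    (Metric.measure_closedBall_pos volume _ hε).ne'
  have h1 : volume (Metric.closedBall (0 : EuclideanSpace ℝ (Fin n)) ε) ≠ ⊤ :=
    measure_closedBall_lt_top.ne
  simp only [noise, Measure.smul_apply, Measure.restrict_apply_univ, smul_eq_mul]
  exact ENNReal.inv_mul_cancel h0 h1

/-- The infinite product of the noise. It is a measure on the space of all parameter sequences,
concentrated on the perturbation space. -/
noncomputable def noiseSeq (n : ℕ) (ε : ℝ) : Measure (ℕ → EuclideanSpace ℝ (Fin n)) :=
  Measure.infinitePi (fun _ : ℕ => noise n ε)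

/-- Weak* convergence: convergence of the integrals of all continuous functions. -/
def WeakStarTendsto {α : Type*} [TopologicalSpace M] [MeasurableSpace M]
    (μs : α → Measure M) (l : Filter α) (μ : Measure M) : Prop :=
  ∀ φ : C(M, ℝ), Tendsto (fun a => ∫ y, φ y ∂(μs a)) l (𝓝 (∫ y, φ y ∂μ))

/-- The time averages of all continuous functions along the perturbed orbit of `x` given by `t`
exist, and are the space averages for `μ`. -/
def TimeAveragesTo [TopologicalSpace M] [MeasurableSpace M]
    (F : M → EuclideanSpace ℝ (Fin n) → M) (x : M) (t : ℕ → EuclideanSpace ℝ (Fin n))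
    (μ : Measure M) : Prop :=
  ∀ φ : C(M, ℝ),
    Tendsto (fun k : ℕ => (k : ℝ)⁻¹ * ∑ j ∈ Finset.range k, φ (iter F t j x)) atTop
      (𝓝 (∫ y, φ y ∂μ))

/-- The noise-averaged frequency of visits during the first `k` perturbed iterates of `x`. -/
noncomputable def visitFrequencyAt [MeasurableSpace M]
    (F : M → EuclideanSpace ℝ (Fin n) → M) (ε : ℝ) (x : M) (k : ℕ) : Measure M :=
  (k : ℝ≥0∞)⁻¹ • ∑ j ∈ Finset.range k, (noiseSeq n ε).map (fun t => iter F t j x)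

/-- The frequency of visits during the first `k` perturbed iterates, averaged over the noise and
over the initial point with respect to `m`. -/
noncomputable def visitFrequency [MeasurableSpace M] (m : Measure M)
    (F : M → EuclideanSpace ℝ (Fin n) → M) (ε : ℝ) (k : ℕ) : Measure M :=
  (k : ℝ≥0∞)⁻¹ •
    ∑ j ∈ Finset.range k, (m.prod (noiseSeq n ε)).map (fun p => iter F p.2 j p.1)

/-- `μ` is the mean sojourn time of the random orbits of `x` at noise level `ε`. -/
def IsMeanSojournTimeAt [TopologicalSpace M] [MeasurableSpace M]
    (F : M → EuclideanSpace ℝ (Fin n) → M) (ε : ℝ) (x : M) (μ : Measure M) : Prop :=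
  IsProbabilityMeasure μ ∧ WeakStarTendsto (visitFrequencyAt F ε x) atTop μ

/-- `μ` is the mean sojourn time of the random orbits of the system at noise level `ε`. -/
def IsMeanSojournTime [TopologicalSpace M] [MeasurableSpace M] (m : Measure M)
    (F : M → EuclideanSpace ℝ (Fin n) → M) (ε : ℝ) (μ : Measure M) : Prop :=
  IsProbabilityMeasure μ ∧ WeakStarTendsto (visitFrequency m F ε) atTop μ

/-- `μ` is a physical measure at noise level `ε`: for a set of points of positive `m`-measure, the
time averages along almost every perturbed orbit are the space averages for `μ`. -/
def IsPhysicalMeasure [TopologicalSpace M] [MeasurableSpace M] (m : Measure M)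
    (F : M → EuclideanSpace ℝ (Fin n) → M) (ε : ℝ) (μ : Measure M) : Prop :=
  IsProbabilityMeasure μ ∧ 0 < m {x | ∀ᵐ t ∂(noiseSeq n ε), TimeAveragesTo F x t μ}

end Orbits

/-! ### Physical random perturbations -/

/-- `F` is a physical random perturbation of `f`, for noise levels in `(0, ε₀)`. Only the values
`F x t` with `‖t‖ < 1` are relevant. -/
structure IsPhysicalRandomPerturbation (d : ℕ) {M : Type*} [EMetricSpace M]
    [ChartedSpace (EuclideanSpace ℝ (Fin d)) M] [MeasurableSpace M]
    [RiemannianBundle (fun x : M => TangentSpace (𝓡 d) x)]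
    (f : M → M) {n : ℕ} (F : M → EuclideanSpace ℝ (Fin n) → M) (ε₀ : ℝ) : Prop where
  pos : 0 < ε₀
  lt_one : ε₀ < 1
  /-- The family is jointly of class `C¹`. -/
  contMDiffOn : ContMDiffOn ((𝓡 d).prod 𝓘(ℝ, EuclideanSpace ℝ (Fin n))) (𝓡 d) 1
    (fun p : M × EuclideanSpace ℝ (Fin n) => F p.1 p.2) (Set.univ ×ˢ Metric.ball 0 1)
  /-- Every map of the family is a diffeomorphism. -/
  diffeo : ∀ t ∈ Metric.ball (0 : EuclideanSpace ℝ (Fin n)) 1,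
    ∃ g : M ≃ₘ^1⟮𝓡 d, 𝓡 d⟯ M, ∀ x, g x = F x t
  /-- The family contains `f` at the origin. -/
  zero : ∀ x, F x 0 = f x
  /-- For every noise level, perturbed iterates of any point eventually cover a ball of fixed radius
  about the unperturbed iterate, and have an absolutely continuous distribution. -/
  cover_and_ac : ∀ ε ∈ Set.Ioo 0 ε₀, ∃ K : ℕ, ∃ ξ : ℝ, 0 < ξ ∧
    (∀ x : M, ∀ j ≥ K, Metric.eball (f^[j] x) (ENNReal.ofReal ξ) ⊆
      (fun t => iter F t j x) '' perturbationSpace n ε) ∧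
    (∀ x : M, ∀ k ≥ K, (noiseSeq n ε).map (fun t => iter F t k x) ≪ normalizedVolume d M)

/-! ### Attractors and stochastic stability -/

/-- `Λ` is an attractor for `f`: a compact invariant set, the maximal invariant set of a trapping
region around it, containing a dense forward orbit. -/
structure IsAttractor {M : Type*} [TopologicalSpace M] (f : M → M) (Λ : Set M) : Prop where
  isCompact : IsCompact Λ
  image_eq : f '' Λ = Λ
  exists_trapping : ∃ U ∈ 𝓝ˢ Λ, f '' closure U ⊆ U ∧ Λ = ⋂ k ≥ 1, f^[k] '' closure U
  transitive : ∃ x ∈ Λ, closure {y | ∃ k ≥ 1, f^[k] x = y} = Λ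

/-- The basin of attraction `W^s(Λ)`. -/
def basin {M : Type*} [EMetricSpace M] (f : M → M) (Λ : Set M) : Set M :=
  {x | Tendsto (fun k => Metric.infEDist (f^[k] x) Λ) atTop (𝓝 0)}

/-- `μ` is the physical measure `μ^ε` localized at `Λ`, at noise level `ε`: there is a completely
forward invariant open set `U` with `Λ ⊆ supp μ ⊆ U`, such that for all points of `U` the time
averages along almost every perturbed orbit are the space averages for `μ`.
If `Λ` is nonempty, there is at most one such `μ`, whatever `U`: look at the averages for a point
of `Λ`. -/
def IsLocalPhysicalMeasure {M : Type*} [TopologicalSpace M] [MeasurableSpace M] {n : ℕ}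
    (F : M → EuclideanSpace ℝ (Fin n) → M) (Λ : Set M) (ε : ℝ) (μ : Measure M) : Prop :=
  IsProbabilityMeasure μ ∧ ∃ U : Set M, IsOpen U ∧
    (∀ t ∈ Metric.closedBall (0 : EuclideanSpace ℝ (Fin n)) ε, ∀ x ∈ closure U, F x t ∈ U) ∧
    Λ ⊆ μ.support ∧ μ.support ⊆ U ∧
    ∀ x ∈ U, ∀ᵐ t ∂(noiseSeq n ε), TimeAveragesTo F x t μ

open Classical in
/-- The physical measure `μ^ε` localized at `Λ` (the zero measure if there is none, which does not
happen for an attractor `Λ`, a physical random perturbation `F` and small `ε > 0`). -/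
noncomputable def localPhysicalMeasure {M : Type*} [TopologicalSpace M] [MeasurableSpace M] {n : ℕ}
    (F : M → EuclideanSpace ℝ (Fin n) → M) (Λ : Set M) (ε : ℝ) : Measure M :=
  if h : ∃ μ : Measure M, IsLocalPhysicalMeasure F Λ ε μ then h.choose else 0

/-- `(Λ, μ)` is stochastically stable with respect to the perturbation `F` of `f`: the invariant
probability measure `μ` has support `Λ`, and is the weak* limit of the localized physical
measures as the noise level tends to zero. -/
structure IsStochasticallyStable {M : Type*} [TopologicalSpace M] [MeasurableSpace M] {n : ℕ}
    (f : M → M) (F : M → EuclideanSpace ℝ (Fin n) → M) (Λ : Set M) (μ : Measure M) : Prop where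
  isProbabilityMeasure : IsProbabilityMeasure μ
  invariant : MeasurePreserving f μ μ
  support_eq : μ.support = Λ
  tendsto : WeakStarTendsto (fun ε => localPhysicalMeasure F Λ ε) (𝓝[>] (0 : ℝ)) μ

end RandomPerturbation

open RandomPerturbation

namespace RandomPerturbation

set_option linter.unusedSectionVars false

/-! ### Random orbits of a family of maps indexed by an arbitrary space -/

section General

variable {X T : Type*}

/-! Fix a noise level `ε`, and let the parameters range over the closed ball of radius `ε`. Consider
the minimal nonempty closed sets that all maps of the family send into themselves. Two of them
coincide or are disjoint, and each contains a ball of a fixed radius by the covering hypothesis, so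
by compactness there are finitely many (`finite_setOf_isMinimalInvariant`).

A minimal set carries only one stationary probability measure
(`IsMinimalInvariant.stationary_unique`). Two of them would yield two mutually singular stationary
measures, both with the whole minimal set as support. But the laws of the `K`-th random iterate have
densities and depend weakly continuously on the point, and by Baire's theorem they are nowhere
mutually singular near some point of the set. Along almost every noise sequence a martingale
argument makes every limit of empirical measures stationary (`ae_tendsto_average_transfer_sub`), so
uniqueness gives the time averages at every point of the minimal set.

From any point almost every random orbit enters some minimal set; this is a maximum principle for
the probability of avoiding an open set (`ae_exists_randomOrbit_mem`). Hence the mean sojourn time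
of every point is a convex combination of the measures of the minimal sets, which are exactly the
physical measures. The weights are the probabilities of ending in the various sets; integrating them
over the initial point gives the global statement (`exists_physical_decomposition`).

For a point of the basin of `Λ` and small `ε`, the random orbits keep returning to a trapping region
of `Λ`. From there some noise leads onto `Λ`, which lies in the open set where the local physical
measure governs the averages, so almost every orbit gets there (`exists_forall_ae_timeAveragesTo`).
Thus the sojourn time is the local physical measure, and stochastic stability gives its limit. The
global limit follows by dominated convergence, since the basins cover almost everything. -/

/-- The orbit of `x` under the successive maps `G · (s 0)`, `G · (s 1)`, …. -/
def randomOrbit (G : X → T → X) (s : ℕ → T) : ℕ → X → X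
  | 0, x => x
  | j + 1, x => G (randomOrbit G s j x) (s j)

/-- Put a new first term in front of a sequence. -/
def prepend (t : T) (s : ℕ → T) : ℕ → T
  | 0 => t
  | n + 1 => s n

@[simp] theorem prepend_zero (t : T) (s : ℕ → T) : prepend t s 0 = t := rfl

@[simp] theorem prepend_succ (t : T) (s : ℕ → T) (n : ℕ) : prepend t s (n + 1) = s n := rfl

theorem randomOrbit_prepend (G : X → T → X) (t : T) (s : ℕ → T) (j : ℕ) (x : X) :
    randomOrbit G (prepend t s) (j + 1) x = randomOrbit G s j (G x t) := by
  induction j with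
  | zero => rfl
  | succ j ih => rw [randomOrbit, ih]; rfl

theorem randomOrbit_add (G : X → T → X) (s : ℕ → T) (i j : ℕ) (x : X) :
    randomOrbit G s (i + j) x = randomOrbit G (fun n => s (i + n)) j (randomOrbit G s i x) := by
  induction j with
  | zero => rfl
  | succ j ih => rw [← add_assoc, randomOrbit, ih]; rfl

theorem randomOrbit_congr (G : X → T → X) {s s' : ℕ → T} {j : ℕ} (h : ∀ i < j, s i = s' i)
    (x : X) : randomOrbit G s j x = randomOrbit G s' j x := by
  induction j with
  | zero => rfl
  | succ j ih =>
    rw [randomOrbit, randomOrbit, ih fun i hi => h i (hi.trans (Nat.lt_succ_self j)),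
      h j (Nat.lt_succ_self j)]

/-- A set is forward invariant if every map of the family sends it into itself. -/
def ForwardInvariant (G : X → T → X) (C : Set X) : Prop :=
  ∀ x ∈ C, ∀ t, G x t ∈ C

theorem ForwardInvariant.randomOrbit_mem {G : X → T → X} {C : Set X} (hC : ForwardInvariant G C)
    {x : X} (hx : x ∈ C) (s : ℕ → T) (j : ℕ) : randomOrbit G s j x ∈ C := by
  induction j with
  | zero => exact hx
  | succ j ih => exact hC _ ih _

theorem ForwardInvariant.randomOrbit_mem_of_le {G : X → T → X} {C : Set X}
    (hC : ForwardInvariant G C) {x : X} {s : ℕ → T} {i j : ℕ} (hij : i ≤ j)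
    (hx : randomOrbit G s i x ∈ C) : randomOrbit G s j x ∈ C := by
  obtain ⟨k, rfl⟩ := Nat.exists_eq_add_of_le hij
  rw [randomOrbit_add]
  exact hC.randomOrbit_mem hx _ _

/-- The set of all points reached from `x`. -/
def reachable (G : X → T → X) (x : X) : Set X :=
  {y | ∃ (s : ℕ → T) (j : ℕ), randomOrbit G s j x = y}

theorem forwardInvariant_reachable (G : X → T → X) (x : X) :
    ForwardInvariant G (reachable G x) := by
  rintro _ ⟨s, j, rfl⟩ t
  refine ⟨fun i => if i < j then s i else t, j + 1, ?_⟩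
  rw [randomOrbit, randomOrbit_congr G (s' := s) fun i hi => if_pos hi]
  simp

end General

section Topology

variable {X T : Type*} [TopologicalSpace X] [TopologicalSpace T] {G : X → T → X}

theorem continuous_randomOrbit (hG : Continuous (fun p : X × T => G p.1 p.2)) (j : ℕ) :
    Continuous (fun p : X × (ℕ → T) => randomOrbit G p.2 j p.1) := by
  induction j with
  | zero => exact continuous_fst
  | succ j ih =>
    exact hG.comp (ih.prodMk ((continuous_apply j).comp continuous_snd))

theorem continuous_randomOrbit_left (hG : Continuous (fun p : X × T => G p.1 p.2)) (j : ℕ)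
    (s : ℕ → T) : Continuous (randomOrbit G s j) :=
  (continuous_randomOrbit hG j).comp (Continuous.prodMk_left s)

theorem continuous_randomOrbit_right (hG : Continuous (fun p : X × T => G p.1 p.2)) (j : ℕ)
    (x : X) : Continuous (fun s => randomOrbit G s j x) :=
  (continuous_randomOrbit hG j).comp (Continuous.prodMk_right x)

theorem ForwardInvariant.closure (hG : Continuous (fun p : X × T => G p.1 p.2)) {C : Set X}
    (hC : ForwardInvariant G C) : ForwardInvariant G (closure C) := by
  intro x hx t
  exact map_mem_closure (f := fun y => G y t) (hG.comp (Continuous.prodMk_left t)) hx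
    fun y hy => hC y hy t

end Topology

/-! ### Splitting off the first term of a noise sequence -/

section Prepend

variable {T : Type*} [MeasurableSpace T]

theorem measurable_prepend : Measurable (fun p : T × (ℕ → T) => prepend p.1 p.2) := by
  refine measurable_pi_iff.2 fun n => ?_
  cases n with
  | zero => exact measurable_fst
  | succ n => exact (measurable_pi_apply n).comp measurable_snd

/-- The infinite product of countably many copies of a probability measure. -/
noncomputable abbrev seqMeasure (lam : Measure T) : Measure (ℕ → T) :=
  Measure.infinitePi (fun _ : ℕ => lam)

/-- Prepending an independent term to an i.i.d. sequence does not change its law. This is the Markov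
property at time one, on which all inductions over time rest. -/
theorem map_prepend (lam : Measure T) [IsProbabilityMeasure lam] :
    (lam.prod (seqMeasure lam)).map (fun p => prepend p.1 p.2) = seqMeasure lam := by
  refine Measure.eq_infinitePi _ fun I A hA => ?_
  rw [Measure.map_apply measurable_prepend (MeasurableSet.pi I.countable_toSet fun i _ => hA i)]
  classical
  set N := I.sup id + 1
  -- Padding with `univ` turns the cylinder into a box over an initial segment of indices, from
  -- which the coordinate `0` splits off.
  set B : ℕ → Set T := fun i => if i ∈ I then A i else univ
  have hB : ∀ i, MeasurableSet (B i) := fun i => by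
    by_cases hi : i ∈ I <;> simp [B, hi, hA i]
  have hpre : (fun p : T × (ℕ → T) => prepend p.1 p.2) ⁻¹' (Set.pi (I : Set ℕ) A) =
      B 0 ×ˢ (Set.pi (Finset.range N : Set ℕ) fun i => B (i + 1)) := by
    ext ⟨t, s⟩
    simp only [mem_preimage, Set.mem_pi, mem_prod, Finset.mem_coe, Finset.mem_range]
    constructor
    · intro h
      refine ⟨?_, fun i _ => ?_⟩
      · by_cases h0 : 0 ∈ I
        · simpa [B, h0] using h 0 h0
        · simp [B, h0]
      · by_cases h0 : i + 1 ∈ I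
        · simpa [B, h0] using h (i + 1) h0
        · simp [B, h0]
    · rintro ⟨h0, h1⟩ i hi
      cases i with
      | zero => simpa [B, hi] using h0
      | succ i =>
        have : i < N := by
          have : i + 1 ≤ I.sup id := Finset.le_sup (f := id) hi
          omega
        simpa [B, hi] using h1 i this
  rw [hpre, Measure.prod_prod, Measure.infinitePi_pi _ (fun i _ => hB (i + 1))]
  have h1 : lam (B 0) * ∏ i ∈ Finset.range N, lam (B (i + 1)) =
      ∏ i ∈ Finset.range (N + 1), lam (B i) :=
    (mul_comm _ _).trans (Finset.prod_range_succ' (fun i => lam (B i)) N).symm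
  rw [h1]
  have hsub : I ⊆ Finset.range (N + 1) := by
    intro i hi
    have : i ≤ I.sup id := Finset.le_sup (f := id) hi
    simp only [Finset.mem_range]; omega
  rw [← Finset.prod_subset hsub]
  · exact Finset.prod_congr rfl fun i hi => by simp [B, hi]
  · intro i _ hi
    simp [B, hi]

theorem seqMeasure_apply_prepend (lam : Measure T) [IsProbabilityMeasure lam] {A : Set (ℕ → T)}
    (hA : MeasurableSet A) :
    seqMeasure lam A = ∫⁻ t, seqMeasure lam {s | prepend t s ∈ A} ∂lam := by
  conv_lhs => rw [← map_prepend lam]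
  rw [Measure.map_apply measurable_prepend hA, Measure.prod_apply (measurable_prepend hA)]
  rfl

theorem integral_prepend (lam : Measure T) [IsProbabilityMeasure lam] {H : (ℕ → T) → ℝ}
    (hH : Measurable H) {B : ℝ} (hB : ∀ s, |H s| ≤ B) :
    ∫ s, H s ∂(seqMeasure lam) = ∫ t, ∫ s, H (prepend t s) ∂(seqMeasure lam) ∂lam := by
  conv_lhs => rw [← map_prepend lam]
  rw [integral_map measurable_prepend.aemeasurable hH.aestronglyMeasurable]
  refine integral_prod (fun p : T × (ℕ → T) => H (prepend p.1 p.2)) ?_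
  exact Integrable.of_bound (hH.comp measurable_prepend).aestronglyMeasurable B
    (Eventually.of_forall fun p => hB _)

theorem ae_of_forall_ae_prepend (lam : Measure T) [IsProbabilityMeasure lam]
    {p : (ℕ → T) → Prop} (hp : MeasurableSet {s | p s})
    (h : ∀ t, ∀ᵐ s ∂(seqMeasure lam), p (prepend t s)) : ∀ᵐ s ∂(seqMeasure lam), p s := by
  rw [ae_iff]
  have hc : MeasurableSet {s | ¬ p s} := hp.compl
  rw [seqMeasure_apply_prepend lam hc]
  refine (lintegral_congr fun t => ?_).trans lintegral_zero
  exact ae_iff.1 (h t)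

end Prepend

/-! ### A maximum principle for the probability of avoiding an open set -/

section Hitting

variable {X T : Type*} [TopologicalSpace X] [CompactSpace X] [TopologicalSpace.MetrizableSpace X]
  [TopologicalSpace T] [SecondCountableTopology T] [MeasurableSpace T] [BorelSpace T]
  {G : X → T → X}

/-- If `y n` tends to `y₀`, the upper limit of the events of avoidance from `y n` has probability at
least `c`. A sequence that avoids `O` from infinitely many `y n` avoids it from `y₀`, because the
complement of `O` is closed and orbits depend continuously on the initial point. -/
theorem isClosed_setOf_le_measure_avoid (hG : Continuous (fun p : X × T => G p.1 p.2))
    (lam : Measure T) [IsProbabilityMeasure lam] {O : Set X} (hO : IsOpen O) (c : ℝ≥0∞) :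
    IsClosed {y | c ≤ seqMeasure lam {s | ∀ j, randomOrbit G s j y ∉ O}} := by
  refine IsSeqClosed.isClosed fun y y₀ hy hlim => ?_
  have hmeas : ∀ y, MeasurableSet {s : ℕ → T | ∀ j, randomOrbit G s j y ∉ O} := fun y => by
    rw [ofPred_forall]
    exact MeasurableSet.iInter fun j =>
      (hO.isClosed_compl.preimage (continuous_randomOrbit_right hG j y)).measurableSet
  set A : ℕ → Set (ℕ → T) := fun n => {s | ∀ j, randomOrbit G s j (y n) ∉ O}
  set B : ℕ → Set (ℕ → T) := fun N => ⋃ n ≥ N, A n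
  have hB : ∀ N, MeasurableSet (B N) := fun N =>
    MeasurableSet.iUnion fun n => MeasurableSet.iUnion fun _ => hmeas _
  have hanti : Antitone B := fun N N' h =>
    biUnion_subset_biUnion_left fun n (hn : N' ≤ n) => h.trans hn
  have htend := tendsto_measure_iInter_atTop (μ := seqMeasure lam)
    (fun N => (hB N).nullMeasurableSet) hanti ⟨0, measure_ne_top _ _⟩
  have h1 : c ≤ seqMeasure lam (⋂ N, B N) :=
    ge_of_tendsto' htend fun N => (hy N).trans
      (measure_mono (subset_biUnion_of_mem (u := A) (show N ∈ {n | n ≥ N} by simp)))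
  refine h1.trans (measure_mono fun s hs j => ?_)
  have hfreq : ∃ᶠ n in atTop, randomOrbit G s j (y n) ∈ Oᶜ := by
    refine frequently_atTop.2 fun N => ?_
    obtain ⟨n, hn, hsn⟩ := mem_iUnion₂.1 (mem_iInter.1 hs N)
    exact ⟨n, hn, hsn j⟩
  exact hO.isClosed_compl.mem_of_frequently_of_tendsto hfreq
    (((continuous_randomOrbit_left hG j s).tendsto y₀).comp hlim)

/-- If an open set can be reached from every point of a closed forward invariant set, then almost
all random orbits starting in the latter visit the former. -/
theorem ae_exists_randomOrbit_mem (hG : Continuous (fun p : X × T => G p.1 p.2))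
    (lam : Measure T) [IsProbabilityMeasure lam] [lam.IsOpenPosMeasure] {O Y : Set X}
    (hO : IsOpen O) (hY : IsClosed Y) (hinv : ForwardInvariant G Y)
    (hreach : ∀ y ∈ Y, (reachable G y ∩ O).Nonempty) {y : X} (hy : y ∈ Y) :
    ∀ᵐ s ∂(seqMeasure lam), ∃ j, randomOrbit G s j y ∈ O := by
  set h : X → ℝ≥0∞ := fun y => seqMeasure lam {s | ∀ j, randomOrbit G s j y ∉ O}
  have husc : UpperSemicontinuous h :=
    upperSemicontinuous_iff_isClosed_preimage.2 fun c => isClosed_setOf_le_measure_avoid hG lam hO c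
  -- Maximum principle: if the maximum of `h` on `Y` were positive, the set where it is attained
  -- would be forward invariant and disjoint from `O`, although `O` can be reached from it.
  obtain ⟨z, hz, hmax⟩ := (husc.upperSemicontinuousOn Y).exists_isMaxOn ⟨y, hy⟩ hY.isCompact
  have hmax' : ∀ x ∈ Y, h x ≤ h z := fun x hx => hmax hx
  suffices hz0 : h z = 0 by
    have : h y = 0 := le_antisymm ((hmax' y hy).trans hz0.le) bot_le
    rw [ae_iff]
    simpa using this
  by_contra hne
  have hZclosed : IsClosed {x | h z ≤ h x} := isClosed_setOf_le_measure_avoid hG lam hO _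
  have hnot : ∀ x, h z ≤ h x → x ∉ O := fun x hx hxO => by
    have : h x = 0 := by
      have : {s : ℕ → T | ∀ j, randomOrbit G s j x ∉ O} = ∅ :=
        eq_empty_of_forall_notMem fun s hs => hs 0 hxO
      simp only [h, this, measure_empty]
    exact hne (le_antisymm (hx.trans this.le) bot_le)
  have hZinv : ForwardInvariant G (Y ∩ {x | h z ≤ h x}) := by
    rintro x ⟨hxY, hx⟩
    have hmeas : MeasurableSet {s : ℕ → T | ∀ j, randomOrbit G s j x ∉ O} := by
      rw [ofPred_forall]
      exact MeasurableSet.iInter fun j =>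
        (hO.isClosed_compl.preimage (continuous_randomOrbit_right hG j x)).measurableSet
    -- As `x` is not in `O`, only the times from one on matter, so `h x` is the mean of `h` over the
    -- random images of `x`. A maximal value can be such a mean only if almost all images are
    -- maximal.
    have hstep : h x = ∫⁻ t, h (G x t) ∂lam := by
      refine (seqMeasure_apply_prepend lam hmeas).trans (lintegral_congr fun t => ?_)
      congr 1
      ext s
      constructor
      · intro hs j
        rw [← randomOrbit_prepend]
        exact hs (j + 1)
      · intro hs j
        cases j with
        | zero => exact hnot x hx
        | succ j => rw [randomOrbit_prepend]; exact hs j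
    have hle : ∀ t, h (G x t) ≤ h z := fun t => hmax' _ (hinv x hxY t)
    have hae : (fun t => h (G x t)) =ᵐ[lam] fun _ => h z := by
      refine ae_eq_of_ae_le_of_lintegral_le (Eventually.of_forall hle) ?_ aemeasurable_const ?_
      · rw [← hstep]; exact measure_ne_top _ _
      · rw [← hstep]; simpa using hx
    -- Almost every parameter becomes every parameter: the set is closed, and `lam` charges all
    -- nonempty open sets.
    have hcl : IsClosed {t | h z ≤ h (G x t)} :=
      hZclosed.preimage (hG.comp (Continuous.prodMk_right x))
    have hdense : Dense {t | h z ≤ h (G x t)} :=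
      Measure.dense_of_ae (μ := lam) (hae.mono fun t ht => ht.ge)
    have huniv := hdense.closure_eq
    rw [hcl.closure_eq] at huniv
    exact fun t => ⟨hinv x hxY t, eq_univ_iff_forall.1 huniv t⟩
  obtain ⟨_, ⟨s, j, rfl⟩, hO'⟩ := hreach z hz
  exact hnot _ (hZinv.randomOrbit_mem ⟨hz, le_refl (h z)⟩ s j).2 hO'

end Hitting

/-! ### Time averages -/

section TimeAverages

variable {X T : Type*} [TopologicalSpace X]

/-- The average of `φ` over the first `k` terms of a sequence. -/
noncomputable def average (φ : C(X, ℝ)) (u : ℕ → X) (k : ℕ) : ℝ :=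
  (k : ℝ)⁻¹ * ∑ j ∈ Finset.range k, φ (u j)

theorem average_sub (φ ψ : C(X, ℝ)) (u : ℕ → X) (k : ℕ) :
    average (φ - ψ) u k = average φ u k - average ψ u k := by
  simp [average, mul_sub]

theorem abs_average_le [CompactSpace X] (φ : C(X, ℝ)) (u : ℕ → X) (k : ℕ) :
    |average φ u k| ≤ ‖φ‖ := by
  rw [average, abs_mul, abs_inv, Nat.abs_cast]
  rcases Nat.eq_zero_or_pos k with rfl | hk
  · simp
  · have : |∑ j ∈ Finset.range k, φ (u j)| ≤ k * ‖φ‖ := by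
      refine (Finset.abs_sum_le_sum_abs _ _).trans ?_
      refine (Finset.sum_le_sum fun j _ => φ.norm_coe_le_norm (u j)).trans ?_
      simp
    have hk' : (0 : ℝ) < k := by exact_mod_cast hk
    rw [inv_mul_le_iff₀ hk']
    exact this

/-- This reduces convergence for all test functions to a countable dense family, which makes the
relevant events measurable and lets countably many null sets be discarded at once. -/
theorem isClosed_setOf_tendsto_zero_of_lipschitz {E : Type*} [PseudoMetricSpace E] {A : ℕ → E → ℝ}
    {L : ℝ} (hA : ∀ k φ ψ, |A k φ - A k ψ| ≤ L * dist φ ψ) :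
    IsClosed {φ | Tendsto (fun k => A k φ) atTop (𝓝 0)} := by
  refine isClosed_of_closure_subset fun φ hφ => ?_
  refine Metric.tendsto_atTop.2 fun ε hε => ?_
  have hL : 0 < |L| + 1 := by positivity
  obtain ⟨ψ, hψ, hd⟩ := Metric.mem_closure_iff.1 hφ (ε / 2 / (|L| + 1)) (by positivity)
  obtain ⟨N, hN⟩ := Metric.tendsto_atTop.1 hψ (ε / 2) (by positivity)
  refine ⟨N, fun n hn => ?_⟩
  have h1 := hN n hn
  rw [Real.dist_0_eq_abs] at h1 ⊢
  have h2 : L * dist φ ψ ≤ ε / 2 := by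
    calc L * dist φ ψ ≤ (|L| + 1) * dist φ ψ := by
          gcongr
          linarith [le_abs_self L]
      _ ≤ (|L| + 1) * (ε / 2 / (|L| + 1)) := by gcongr
      _ = ε / 2 := by field_simp
  have h3 := hA n φ ψ
  have h4 : |A n φ| ≤ |A n φ - A n ψ| + |A n ψ| := by
    have := abs_add_le (A n φ - A n ψ) (A n ψ)
    simpa using this
  linarith

/-- The time averages of all continuous functions along the random orbit of `x` given by `s` are
the space averages for `ν`. -/
def HasTimeAverages [MeasurableSpace X] (G : X → T → X) (ν : Measure X) (x : X) (s : ℕ → T) :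
    Prop :=
  ∀ φ : C(X, ℝ), Tendsto (average φ fun j => randomOrbit G s j x) atTop (𝓝 (∫ y, φ y ∂ν))

theorem tendsto_average_succ {φ : C(X, ℝ)} {u : ℕ → X} {l : ℝ}
    (h : Tendsto (average φ fun j => u (j + 1)) atTop (𝓝 l)) :
    Tendsto (average φ u) atTop (𝓝 l) := by
  rw [← tendsto_add_atTop_iff_nat 1]
  have h1 : Tendsto (fun k : ℕ => (k : ℝ) / (k + 1)) atTop (𝓝 1) :=
    tendsto_natCast_div_add_atTop 1
  have h2 : Tendsto (fun k : ℕ => (1 / ((k : ℝ) + 1)) * φ (u 0)) atTop (𝓝 0) := by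
    simpa using tendsto_one_div_add_atTop_nhds_zero_nat.mul_const (φ (u 0))
  have h3 := (h1.mul h).add h2
  simp only [one_mul, add_zero] at h3
  refine h3.congr fun k => ?_
  rw [average, average, Finset.sum_range_succ']
  rcases Nat.eq_zero_or_pos k with rfl | hk
  · simp
  · have : (k : ℝ) ≠ 0 := by exact_mod_cast hk.ne'
    push_cast
    field_simp

theorem HasTimeAverages.prepend [MeasurableSpace X] {G : X → T → X} {ν : Measure X} {x : X} {t : T}
    {s : ℕ → T} (h : HasTimeAverages G ν (G x t) s) :
    HasTimeAverages G ν x (prepend t s) := fun φ => by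
  refine tendsto_average_succ ?_
  simp only [randomOrbit_prepend]
  exact h φ

end TimeAverages

section MeasurableTimeAverages

variable {X T : Type*} [TopologicalSpace X] [CompactSpace X] [TopologicalSpace.MetrizableSpace X]
  [MeasurableSpace X] [BorelSpace X]
  [TopologicalSpace T] [SecondCountableTopology T] [MeasurableSpace T] [BorelSpace T]
  {G : X → T → X}

theorem hasTimeAverages_iff_denseSeq (ν : Measure X) [IsProbabilityMeasure ν] (x : X) (s : ℕ → T) :
    HasTimeAverages G ν x s ↔ ∀ n, Tendsto
      (average (TopologicalSpace.denseSeq C(X, ℝ) n) fun j => randomOrbit G s j x) atTop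
      (𝓝 (∫ y, TopologicalSpace.denseSeq C(X, ℝ) n y ∂ν)) := by
  refine ⟨fun h n => h _, fun h => ?_⟩
  set A : ℕ → C(X, ℝ) → ℝ := fun k φ =>
    average φ (fun j => randomOrbit G s j x) k - ∫ y, φ y ∂ν
  have hint : ∀ φ : C(X, ℝ), Integrable φ ν := fun φ =>
    Integrable.of_bound φ.continuous.aestronglyMeasurable ‖φ‖
      (Eventually.of_forall φ.norm_coe_le_norm)
  have hA : ∀ k φ ψ, |A k φ - A k ψ| ≤ 2 * dist φ ψ := fun k φ ψ => by
    have h1 : A k φ - A k ψ = average (φ - ψ) (fun j => randomOrbit G s j x) k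
        - ∫ y, (φ - ψ) y ∂ν := by
      have : ∫ y, (φ - ψ) y ∂ν = ∫ y, φ y ∂ν - ∫ y, ψ y ∂ν := integral_sub (hint φ) (hint ψ)
      rw [average_sub, this]
      simp only [A]; ring
    have h2 : |∫ y, (φ - ψ) y ∂ν| ≤ ‖φ - ψ‖ := by
      have := norm_integral_le_of_norm_le_const (μ := ν)
        (Eventually.of_forall (φ - ψ).norm_coe_le_norm)
      simpa using this
    rw [h1, dist_eq_norm]
    have := abs_sub (average (φ - ψ) (fun j => randomOrbit G s j x) k) (∫ y, (φ - ψ) y ∂ν)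
    linarith [abs_average_le (φ - ψ) (fun j => randomOrbit G s j x) k]
  have hclosed := isClosed_setOf_tendsto_zero_of_lipschitz hA
  have huniv : {φ | Tendsto (fun k => A k φ) atTop (𝓝 0)} = univ := by
    refine eq_univ_of_forall fun φ => ?_
    refine hclosed.closure_subset_iff.2 ?_ (TopologicalSpace.denseRange_denseSeq C(X, ℝ) φ)
    rintro _ ⟨n, rfl⟩
    exact tendsto_sub_nhds_zero_iff.2 (h n)
  intro φ
  exact tendsto_sub_nhds_zero_iff.1 (eq_univ_iff_forall.1 huniv φ)

theorem measurableSet_hasTimeAverages (hG : Continuous (fun p : X × T => G p.1 p.2))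
    (ν : Measure X) [IsProbabilityMeasure ν] (x : X) :
    MeasurableSet {s | HasTimeAverages G ν x s} := by
  simp only [hasTimeAverages_iff_denseSeq, ofPred_forall]
  refine MeasurableSet.iInter fun n => measurableSet_tendsto _ fun k => ?_
  refine Continuous.measurable ?_
  exact continuous_const.mul (continuous_finsetSum _ fun j _ =>
    (map_continuous _).comp (continuous_randomOrbit_right hG j x))

/-- If almost all orbits from points of `D` have time averages `ν`, then so do almost all those
orbits, from an arbitrary point, which are in `D` at a given time. -/
theorem ae_hasTimeAverages_of_randomOrbit_mem (hG : Continuous (fun p : X × T => G p.1 p.2))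
    (lam : Measure T) [IsProbabilityMeasure lam] (ν : Measure X) [IsProbabilityMeasure ν]
    {D : Set X} (hD : MeasurableSet D)
    (h : ∀ x ∈ D, ∀ᵐ s ∂(seqMeasure lam), HasTimeAverages G ν x s) (j : ℕ) (x : X) :
    ∀ᵐ s ∂(seqMeasure lam), randomOrbit G s j x ∈ D → HasTimeAverages G ν x s := by
  induction j generalizing x with
  | zero =>
    by_cases hx : x ∈ D
    · exact (h x hx).mono fun s hs _ => hs
    · exact Eventually.of_forall fun s hs => (hx hs).elim
  | succ j ih =>
    -- Conditioning on the first parameter shifts the visit to `D` one step earlier, for the orbit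
    -- of `G x t`; a first step does not affect time averages.
    refine ae_of_forall_ae_prepend lam ?_ fun t => ?_
    · exact (hD.preimage (continuous_randomOrbit_right hG (j + 1) x).measurable).imp
        (measurableSet_hasTimeAverages hG ν x)
    · filter_upwards [ih (G x t)] with s hs hmem
      rw [randomOrbit_prepend] at hmem
      exact (hs hmem).prepend

end MeasurableTimeAverages

/-! ### The law of large numbers for the increments of a random orbit -/

section Transfer

variable {X T : Type*} [TopologicalSpace X] [CompactSpace X] [TopologicalSpace.MetrizableSpace X]
  [TopologicalSpace T] [SecondCountableTopology T] [MeasurableSpace T] [BorelSpace T]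
  {G : X → T → X}

/-- The operator averaging a continuous function over the random image of a point. -/
noncomputable def transfer (hG : Continuous (fun p : X × T => G p.1 p.2)) (lam : Measure T)
    [IsProbabilityMeasure lam] (g : C(X, ℝ)) : C(X, ℝ) where
  toFun x := ∫ t, g (G x t) ∂lam
  continuous_toFun := by
    refine continuous_of_dominated (bound := fun _ => ‖g‖) (fun x => ?_) (fun x => ?_)
      (integrable_const _) ?_
    · exact ((map_continuous g).comp (hG.comp (Continuous.prodMk_right x))).aestronglyMeasurable
    · exact Eventually.of_forall fun t => g.norm_coe_le_norm _
    · exact Eventually.of_forall fun t => (map_continuous g).comp (hG.comp (Continuous.prodMk_left t))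

theorem integrable_comp_map (hG : Continuous (fun p : X × T => G p.1 p.2)) (lam : Measure T)
    [IsProbabilityMeasure lam] (g : C(X, ℝ)) (x : X) : Integrable (fun t => g (G x t)) lam :=
  Integrable.of_bound
    ((map_continuous g).comp (hG.comp (Continuous.prodMk_right x))).aestronglyMeasurable ‖g‖
    (Eventually.of_forall fun _ => g.norm_coe_le_norm _)

variable (hG : Continuous (fun p : X × T => G p.1 p.2)) (lam : Measure T) [IsProbabilityMeasure lam]

theorem transfer_apply (g : C(X, ℝ)) (x : X) : transfer hG lam g x = ∫ t, g (G x t) ∂lam := rfl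

theorem abs_transfer_apply_le (g : C(X, ℝ)) (x : X) : |transfer hG lam g x| ≤ ‖g‖ := by
  have := norm_integral_le_of_norm_le_const (μ := lam) (f := fun t => g (G x t))
    (Eventually.of_forall fun t => g.norm_coe_le_norm _)
  simpa [transfer_apply] using this

theorem norm_transfer_le (g : C(X, ℝ)) : ‖transfer hG lam g‖ ≤ ‖g‖ :=
  (ContinuousMap.norm_le _ (norm_nonneg _)).2 (abs_transfer_apply_le hG lam g)

theorem transfer_sub (g h : C(X, ℝ)) :
    transfer hG lam (g - h) = transfer hG lam g - transfer hG lam h := by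
  ext x
  exact integral_sub (integrable_comp_map hG lam g x) (integrable_comp_map hG lam h x)

/-- The sum of the deviations of `g` along a random orbit from the conditional means. -/
noncomputable def deviation (g : C(X, ℝ)) (n : ℕ) (x : X) (s : ℕ → T) : ℝ :=
  ∑ j ∈ Finset.range n, (g (randomOrbit G s (j + 1) x) - transfer hG lam g (randomOrbit G s j x))

theorem deviation_prepend (g : C(X, ℝ)) (n : ℕ) (x : X) (t : T) (s : ℕ → T) :
    deviation hG lam g (n + 1) x (prepend t s) =
      (g (G x t) - transfer hG lam g x) + deviation hG lam g n (G x t) s := by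
  rw [deviation, Finset.sum_range_succ', add_comm]
  simp only [randomOrbit_prepend, deviation]
  rfl

theorem continuous_deviation (g : C(X, ℝ)) (n : ℕ) (x : X) :
    Continuous (deviation hG lam g n x) :=
  continuous_finsetSum _ fun j _ =>
    ((map_continuous g).comp (continuous_randomOrbit_right hG (j + 1) x)).sub
      ((map_continuous _).comp (continuous_randomOrbit_right hG j x))

theorem abs_deviation_step_le (g : C(X, ℝ)) (x y : X) :
    |g y - transfer hG lam g x| ≤ 2 * ‖g‖ := by
  have h1 : |g y| ≤ ‖g‖ := g.norm_coe_le_norm y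
  have h2 := abs_transfer_apply_le hG lam g x
  have := abs_sub (g y) (transfer hG lam g x)
  linarith

theorem abs_deviation_le (g : C(X, ℝ)) (n : ℕ) (x : X) (s : ℕ → T) :
    |deviation hG lam g n x s| ≤ n * (2 * ‖g‖) := by
  refine (Finset.abs_sum_le_sum_abs _ _).trans ?_
  refine (Finset.sum_le_sum fun j _ => abs_deviation_step_le hG lam g _ _).trans ?_
  simp

theorem integrable_deviation (g : C(X, ℝ)) (n : ℕ) (x : X) :
    Integrable (deviation hG lam g n x) (seqMeasure lam) :=
  Integrable.of_bound (continuous_deviation hG lam g n x).aestronglyMeasurable _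
    (Eventually.of_forall (abs_deviation_le hG lam g n x))

theorem integral_deviation (g : C(X, ℝ)) (n : ℕ) (x : X) :
    ∫ s, deviation hG lam g n x s ∂(seqMeasure lam) = 0 := by
  induction n generalizing x with
  | zero => simp [deviation]
  | succ n ih =>
    rw [integral_prepend lam (continuous_deviation hG lam g (n + 1) x).measurable
      (abs_deviation_le hG lam g (n + 1) x)]
    simp only [deviation_prepend]
    have h1 : ∀ t, ∫ s, (g (G x t) - transfer hG lam g x + deviation hG lam g n (G x t) s)
        ∂(seqMeasure lam) = g (G x t) - transfer hG lam g x := fun t => by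
      rw [integral_add (integrable_const _) (integrable_deviation hG lam g n _), ih]
      simp
    simp only [h1]
    rw [integral_sub (integrable_comp_map hG lam g x) (integrable_const _)]
    simp [transfer_apply]

theorem sq_deviation_le (g : C(X, ℝ)) (n : ℕ) (x : X) (s : ℕ → T) :
    deviation hG lam g n x s ^ 2 ≤ (n * (2 * ‖g‖)) ^ 2 :=
  sq_le_sq.2 ((abs_deviation_le hG lam g n x s).trans (le_abs_self _))

theorem integrable_sq_deviation (g : C(X, ℝ)) (n : ℕ) (x : X) :
    Integrable (fun s => deviation hG lam g n x s ^ 2) (seqMeasure lam) :=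
  Integrable.of_bound ((continuous_deviation hG lam g n x).pow 2).aestronglyMeasurable _
    (Eventually.of_forall fun s => by
      rw [Real.norm_eq_abs, abs_of_nonneg (sq_nonneg _)]
      exact sq_deviation_le hG lam g n x s)

/-- The increments are martingale differences. After splitting off the first one, the cross term has
mean zero by `integral_deviation`, so the second moment grows only linearly. -/
theorem integral_sq_deviation_le (g : C(X, ℝ)) (n : ℕ) (x : X) :
    ∫ s, deviation hG lam g n x s ^ 2 ∂(seqMeasure lam) ≤ n * (2 * ‖g‖) ^ 2 := by
  induction n generalizing x with
  | zero => simp [deviation]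
  | succ n ih =>
    rw [integral_prepend lam (H := fun s => deviation hG lam g (n + 1) x s ^ 2)
      ((continuous_deviation hG lam g (n + 1) x).pow 2).measurable
      (B := (((n + 1 : ℕ) : ℝ) * (2 * ‖g‖)) ^ 2)
      (fun s => by
        rw [abs_of_nonneg (sq_nonneg _)]
        exact sq_deviation_le hG lam g (n + 1) x s)]
    have h1 : ∀ t, ∫ s, deviation hG lam g (n + 1) x (prepend t s) ^ 2 ∂(seqMeasure lam) ≤
        ((n + 1 : ℕ) : ℝ) * (2 * ‖g‖) ^ 2 := fun t => by
      set a := g (G x t) - transfer hG lam g x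
      have h2 : ∀ s, deviation hG lam g (n + 1) x (prepend t s) ^ 2 =
          (a ^ 2 + 2 * a * deviation hG lam g n (G x t) s) + deviation hG lam g n (G x t) s ^ 2 :=
        fun s => by rw [deviation_prepend]; ring
      simp only [h2]
      have hI : Integrable (fun s => a ^ 2 + 2 * a * deviation hG lam g n (G x t) s)
          (seqMeasure lam) :=
        (integrable_const _).add ((integrable_deviation hG lam g n _).const_mul _)
      rw [integral_add hI (integrable_sq_deviation hG lam g n _),
        integral_add (integrable_const _) ((integrable_deviation hG lam g n _).const_mul _),
        integral_const_mul, integral_deviation]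
      have h3 : a ^ 2 ≤ (2 * ‖g‖) ^ 2 :=
        sq_le_sq.2 ((abs_deviation_step_le hG lam g _ _).trans (le_abs_self _))
      have h4 := ih (G x t)
      simp only [integral_const, probReal_univ, one_smul, mul_zero, add_zero]
      push_cast
      linarith
    have h5 := norm_integral_le_of_norm_le_const (μ := lam)
      (f := fun t => ∫ s, deviation hG lam g (n + 1) x (prepend t s) ^ 2 ∂(seqMeasure lam))
      (Eventually.of_forall fun t => by
        rw [Real.norm_eq_abs, abs_of_nonneg (integral_nonneg fun s => sq_nonneg _)]
        exact h1 t)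
    simp only [probReal_univ, mul_one] at h5
    exact (le_abs_self _).trans h5

/-- At the times `(k + 1) ^ 2` the second moments of the quotients are at most a constant over `(k +
1) ^ 2`. They are summable, so almost surely the squares of the quotients have a finite sum. -/
theorem ae_tendsto_deviation_subseq (g : C(X, ℝ)) (x : X) :
    ∀ᵐ s ∂(seqMeasure lam), Tendsto
      (fun k : ℕ => deviation hG lam g ((k + 1) ^ 2) x s / ((k + 1) ^ 2 : ℕ)) atTop (𝓝 0) := by
  set B := (2 * ‖g‖) ^ 2
  have hmeas : ∀ k : ℕ, Measurable fun s =>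
      ENNReal.ofReal ((deviation hG lam g ((k + 1) ^ 2) x s / ((k + 1) ^ 2 : ℕ)) ^ 2) := fun k =>
    (((continuous_deviation hG lam g _ x).measurable.div_const _).pow_const 2).ennreal_ofReal
  have hle : ∀ k : ℕ, ∫⁻ s,
      ENNReal.ofReal ((deviation hG lam g ((k + 1) ^ 2) x s / ((k + 1) ^ 2 : ℕ)) ^ 2)
        ∂(seqMeasure lam) ≤ ENNReal.ofReal (B * (1 / ((k + 1 : ℕ) : ℝ) ^ 2)) := fun k => by
    have hk : (0 : ℝ) < ((k + 1 : ℕ) : ℝ) := by positivity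
    rw [← ofReal_integral_eq_lintegral_ofReal]
    · refine ENNReal.ofReal_le_ofReal ?_
      simp only [div_pow]
      rw [integral_div, div_le_iff₀ (by positivity)]
      refine (integral_sq_deviation_le hG lam g _ x).trans (le_of_eq ?_)
      push_cast
      field_simp
      simp only [B]
      ring
    · simp only [div_pow]
      exact (integrable_sq_deviation hG lam g _ x).div_const _
    · exact Eventually.of_forall fun s => sq_nonneg _
  have hsum : ∫⁻ s, ∑' k : ℕ,
      ENNReal.ofReal ((deviation hG lam g ((k + 1) ^ 2) x s / ((k + 1) ^ 2 : ℕ)) ^ 2)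
        ∂(seqMeasure lam) ≠ ⊤ := by
    rw [lintegral_tsum fun k => (hmeas k).aemeasurable]
    refine ne_top_of_le_ne_top ?_ (ENNReal.tsum_le_tsum hle)
    have hs : Summable fun k : ℕ => B * (1 / ((k + 1 : ℕ) : ℝ) ^ 2) :=
      ((summable_nat_add_iff 1).2 (Real.summable_one_div_nat_pow.2 one_lt_two)).mul_left B
    exact hs.tsum_ofReal_ne_top
  filter_upwards [ae_lt_top (Measurable.tsum hmeas) hsum] with s hs
  have h1 := ENNReal.tendsto_atTop_zero_of_tsum_ne_top hs.ne
  have h2 := (ENNReal.tendsto_toReal ENNReal.zero_ne_top).comp h1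
  have h3 : Tendsto (fun k : ℕ => (deviation hG lam g ((k + 1) ^ 2) x s / ((k + 1) ^ 2 : ℕ)) ^ 2)
      atTop (𝓝 0) := by
    refine h2.congr fun k => ?_
    exact ENNReal.toReal_ofReal (sq_nonneg _)
  have h4 := h3.sqrt
  simp only [Real.sqrt_sq_eq_abs, Real.sqrt_zero] at h4
  exact (tendsto_zero_iff_abs_tendsto_zero _).2 h4

/-- The gaps between squares are filled by monotonicity: adding `B * n`, with `B` a bound for one
increment, makes the sum monotone in `n`, and ratios of consecutive squares tend to one. -/
theorem ae_tendsto_deviation_div (g : C(X, ℝ)) (x : X) :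
    ∀ᵐ s ∂(seqMeasure lam), Tendsto (fun n : ℕ => deviation hG lam g n x s / n) atTop (𝓝 0) := by
  filter_upwards [ae_tendsto_deviation_subseq hG lam g x] with s hs
  set B := 2 * ‖g‖
  have hmono : Monotone fun n : ℕ => deviation hG lam g n x s + B * n := by
    refine monotone_nat_of_le_succ fun n => ?_
    rw [deviation, deviation, Finset.sum_range_succ]
    have := neg_le_of_abs_le
      (abs_deviation_step_le hG lam g (randomOrbit G s n x) (randomOrbit G s (n + 1) x))
    push_cast
    linarith
  have hkey := tendsto_div_of_monotone_of_exists_subseq_tendsto_div _ B hmono fun a ha => by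
    refine ⟨fun k => (k + 1) ^ 2, ?_, ?_, ?_⟩
    · have h1 : Tendsto (fun k : ℕ => (1 + 1 / ((k : ℝ) + 1)) ^ 2) atTop (𝓝 1) := by
        simpa using ((tendsto_one_div_add_atTop_nhds_zero_nat (𝕜 := ℝ)).const_add 1).pow 2
      filter_upwards [h1.eventually_le_const ha] with k hk
      have hk' : (0 : ℝ) < (k : ℝ) + 1 := by positivity
      push_cast
      calc ((k : ℝ) + 1 + 1) ^ 2 = (1 + 1 / ((k : ℝ) + 1)) ^ 2 * ((k : ℝ) + 1) ^ 2 := by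
            field_simp
        _ ≤ a * ((k : ℝ) + 1) ^ 2 := by gcongr
    · exact (tendsto_pow_atTop two_ne_zero).comp (tendsto_add_atTop_nat 1)
    · have h1 := hs.add_const B
      rw [zero_add] at h1
      refine h1.congr fun k => ?_
      have : (((k + 1) ^ 2 : ℕ) : ℝ) ≠ 0 := by positivity
      field_simp
  have h2 := hkey.sub_const B
  rw [sub_self] at h2
  refine h2.congr' ?_
  filter_upwards [eventually_gt_atTop 0] with n hn
  have : (n : ℝ) ≠ 0 := by exact_mod_cast hn.ne'
  field_simp
  ring

/-- With `x_j` the orbit and `P` the transfer operator, `Pg(x_j) - g(x_j)` is the telescoping term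
`g(x_{j+1}) - g(x_j)` minus the martingale increment `g(x_{j+1}) - Pg(x_j)`. -/
theorem average_transfer_sub (g : C(X, ℝ)) (x : X) (s : ℕ → T) (n : ℕ) :
    average (transfer hG lam g - g) (fun j => randomOrbit G s j x) n =
      (g (randomOrbit G s n x) - g x) / n - deviation hG lam g n x s / n := by
  have h : ∑ j ∈ Finset.range n, (transfer hG lam g - g) (randomOrbit G s j x) =
      (g (randomOrbit G s n x) - g x) - deviation hG lam g n x s := by
    have h1 := Finset.sum_range_sub (fun j => g (randomOrbit G s j x)) n
    have h2 : g (randomOrbit G s 0 x) = g x := rfl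
    rw [h2] at h1
    rw [← h1, deviation, ← Finset.sum_sub_distrib]
    refine Finset.sum_congr rfl fun j _ => ?_
    rw [ContinuousMap.sub_apply]
    ring
  rw [average, h]
  ring

/-- Along almost every random orbit, the averages of all the functions `Pg - g` tend to zero. -/
theorem ae_tendsto_average_transfer_sub (x : X) :
    ∀ᵐ s ∂(seqMeasure lam), ∀ g : C(X, ℝ), Tendsto
      (average (transfer hG lam g - g) fun j => randomOrbit G s j x) atTop (𝓝 0) := by
  have h := fun n => ae_tendsto_deviation_div hG lam (TopologicalSpace.denseSeq C(X, ℝ) n) x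
  filter_upwards [ae_all_iff.2 h] with s hs
  set A : ℕ → C(X, ℝ) → ℝ := fun k g =>
    average (transfer hG lam g - g) (fun j => randomOrbit G s j x) k
  have hA : ∀ k φ ψ, |A k φ - A k ψ| ≤ 2 * dist φ ψ := fun k φ ψ => by
    simp only [A]
    rw [← average_sub, sub_sub_sub_comm, ← transfer_sub, dist_eq_norm]
    have h1 := norm_sub_le (transfer hG lam (φ - ψ)) (φ - ψ)
    have h2 := norm_transfer_le hG lam (φ - ψ)
    have h3 := abs_average_le (transfer hG lam (φ - ψ) - (φ - ψ))
      (fun j => randomOrbit G s j x) k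
    linarith
  have hclosed := isClosed_setOf_tendsto_zero_of_lipschitz hA
  intro g
  refine hclosed.closure_subset_iff.2 ?_ (TopologicalSpace.denseRange_denseSeq C(X, ℝ) g)
  rintro _ ⟨n, rfl⟩
  set g := TopologicalSpace.denseSeq C(X, ℝ) n
  have h1 : Tendsto (fun n : ℕ => (g (randomOrbit G s n x) - g x) / (n : ℝ)) atTop (𝓝 0) := by
    refine squeeze_zero_norm (a := fun n : ℕ => (2 * ‖g‖) / n) (fun n => ?_)
      (tendsto_const_div_atTop_nhds_zero_nat _)
    rw [norm_div, Real.norm_natCast]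
    gcongr
    have h3 := norm_sub_le (g (randomOrbit G s n x)) (g x)
    linarith [g.norm_coe_le_norm (randomOrbit G s n x), g.norm_coe_le_norm x]
  have h2 := h1.sub (hs n)
  rw [sub_zero] at h2
  exact h2.congr fun n => (average_transfer_sub hG lam g x s n).symm

end Transfer

/-! ### Families of measures with densities that depend weakly continuously on the point -/

section Baire

variable {X : Type*} [TopologicalSpace X] [CompactSpace X] [TopologicalSpace.MetrizableSpace X]
  [MeasurableSpace X] [BorelSpace X]

theorem integrable_continuousMap (φ : C(X, ℝ)) (ν : Measure X) [IsFiniteMeasure ν] :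
    Integrable φ ν :=
  Integrable.of_bound φ.continuous.aestronglyMeasurable ‖φ‖
    (Eventually.of_forall φ.norm_coe_le_norm)

/-- Two mutually singular probability measures are separated by a continuous function. -/
theorem exists_half_lt_integral_sub {ν ν' : Measure X} [IsProbabilityMeasure ν]
    [IsProbabilityMeasure ν'] (h : ν ⟂ₘ ν') :
    ∃ φ : C(X, ℝ), ‖φ‖ ≤ 1 ∧ 1 / 2 < ∫ x, φ x ∂ν' - ∫ x, φ x ∂ν := by
  obtain ⟨A, hA, hνA, hνA'⟩ := h
  have h1 : ν Aᶜ = 1 := by rw [measure_compl hA (measure_ne_top _ _)]; simp [hνA]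
  have h2 : ν' A = 1 := by
    rw [← compl_compl A, measure_compl hA.compl (measure_ne_top _ _)]; simp [hνA']
  -- With an error of `1/4`, each compact set carries more than `3/4` of its measure. A function
  -- that is `0` on `K₁` and `1` on `K₂` then has integrals below `1/4` and above `3/4`.
  have hq : ENNReal.ofReal (1 / 4) ≠ 0 := by simp
  obtain ⟨K₁, hK₁, hc₁, hlt₁⟩ := hA.compl.exists_isCompact_lt_add (measure_ne_top ν _) hq
  obtain ⟨K₂, hK₂, hc₂, hlt₂⟩ := hA.exists_isCompact_lt_add (measure_ne_top ν' _) hq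
  have hdisj : Disjoint K₁ K₂ :=
    disjoint_left.2 fun x hx hx' => hK₁ hx (hK₂ hx')
  obtain ⟨φ, hφ₁, hφ₂, hφ⟩ := exists_continuous_zero_one_of_isClosed hc₁.isClosed hc₂.isClosed hdisj
  have hr₁ : 3 / 4 < ν.real K₁ := by
    rw [h1, ← ofReal_measureReal (μ := ν) (s := K₁),
      ← ENNReal.ofReal_add measureReal_nonneg (by norm_num), ← ENNReal.ofReal_one,
      ENNReal.ofReal_lt_ofReal_iff_of_nonneg zero_le_one] at hlt₁
    linarith
  have hr₂ : 3 / 4 < ν'.real K₂ := by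
    rw [h2, ← ofReal_measureReal (μ := ν') (s := K₂),
      ← ENNReal.ofReal_add measureReal_nonneg (by norm_num), ← ENNReal.ofReal_one,
      ENNReal.ofReal_lt_ofReal_iff_of_nonneg zero_le_one] at hlt₂
    linarith
  refine ⟨φ, (ContinuousMap.norm_le _ zero_le_one).2 fun x => ?_, ?_⟩
  · rw [Real.norm_eq_abs, abs_of_nonneg (hφ x).1]; exact (hφ x).2
  have hi₁ : ∫ x, φ x ∂ν ≤ ν.real K₁ᶜ := by
    rw [← integral_indicator_one hc₁.isClosed.measurableSet.compl]
    refine integral_mono (integrable_continuousMap φ ν)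
      ((integrable_const (1 : ℝ)).indicator hc₁.isClosed.measurableSet.compl) fun x => ?_
    by_cases hx : x ∈ K₁
    · simp [hx, hφ₁ hx]
    · simpa [hx] using (hφ x).2
  have hi₂ : ν'.real K₂ ≤ ∫ x, φ x ∂ν' := by
    rw [← integral_indicator_one hc₂.isClosed.measurableSet]
    refine integral_mono ((integrable_const (1 : ℝ)).indicator hc₂.isClosed.measurableSet)
      (integrable_continuousMap φ ν') fun x => ?_
    by_cases hx : x ∈ K₂
    · simp [hx, hφ₂ hx]
    · simpa [hx] using (hφ x).1
  rw [probReal_compl_eq_one_sub hc₁.isClosed.measurableSet] at hi₁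
  linarith

/-- By Baire's theorem, a weakly continuous family of probability measures with densities is
nearly continuous in total variation somewhere. -/
theorem exists_isOpen_not_mutuallySingular {κ : X → Measure X} [∀ x, IsProbabilityMeasure (κ x)]
    (hκ : ∀ φ : C(X, ℝ), Continuous fun x => ∫ y, φ y ∂(κ x)) {m : Measure X} [IsFiniteMeasure m]
    (hac : ∀ x, κ x ≪ m) {C : Set X} (hC : IsClosed C) (hne : C.Nonempty) :
    ∃ V, IsOpen V ∧ (C ∩ V).Nonempty ∧ ∀ x ∈ C ∩ V, ∀ y ∈ C ∩ V, ¬ κ x ⟂ₘ κ y := by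
  have : CompactSpace C := isCompact_iff_compactSpace.1 hC.isCompact
  have : Nonempty C := hne.to_subtype
  have : Fact ((1 : ℝ≥0∞) ≠ ⊤) := ⟨ENNReal.one_ne_top⟩
  have : TopologicalSpace.SeparableSpace (Lp ℝ 1 m) := inferInstance
  set g : ℕ → Lp ℝ 1 m := TopologicalSpace.denseSeq (Lp ℝ 1 m)
  -- `E i` consists of the points whose law is within `1/4` of the density `g i`, tested on the unit
  -- ball of continuous functions; hence it is closed. Two laws in the same `E i` differ by at most
  -- `1/2` on such functions, which excludes singularity.
  set E : ℕ → Set C := fun i =>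
    {x | ∀ φ : C(X, ℝ), ‖φ‖ ≤ 1 → |∫ y, φ y ∂(κ x) - ∫ y, g i y * φ y ∂m| ≤ 1 / 4}
  have hE : ∀ i, IsClosed (E i) := fun i => by
    simp only [E, ofPred_forall]
    refine isClosed_iInter fun φ => isClosed_iInter fun _ => ?_
    exact isClosed_le
      ((((hκ φ).comp continuous_subtype_val).sub continuous_const).abs) continuous_const
  -- The Radon–Nikodym density of each law is approximated in `L¹` by the dense sequence.
  have hcover : ⋃ i, E i = univ := by
    refine eq_univ_of_forall fun x => ?_
    set p : X → ℝ := fun y => ((κ x).rnDeriv m y).toReal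
    have hp : Integrable p m := Measure.integrable_toReal_rnDeriv
    obtain ⟨i, hi⟩ := (TopologicalSpace.denseRange_denseSeq (Lp ℝ 1 m)).exists_dist_lt
      (hp.toL1 p) (show (0 : ℝ) < 1 / 4 by norm_num)
    refine mem_iUnion.2 ⟨i, fun φ hφ => ?_⟩
    have hgi : Integrable (g i) m := L1.integrable_coeFn _
    have hφm : AEStronglyMeasurable φ m := φ.continuous.aestronglyMeasurable
    have hb : ∀ᵐ y ∂m, ‖φ y‖ ≤ 1 :=
      Eventually.of_forall fun y => (φ.norm_coe_le_norm y).trans hφ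
    have h1 : ∫ y, φ y ∂(κ x) = ∫ y, p y * φ y ∂m := (integral_rnDeriv_smul (hac x)).symm
    rw [h1, ← integral_sub (hp.mul_bdd hφm hb) (hgi.mul_bdd hφm hb)]
    have h2 : ∫ y, ‖p y - g i y‖ ∂m ≤ 1 / 4 := by
      have h3 : dist (hp.toL1 p) (g i) = ∫ y, ‖p y - g i y‖ ∂m := by
        rw [dist_eq_norm, L1.norm_eq_integral_norm]
        refine integral_congr_ae ?_
        filter_upwards [Lp.coeFn_sub (hp.toL1 p) (g i), hp.coeFn_toL1] with y hy hy'
        rw [hy, Pi.sub_apply, hy']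
      rw [← h3]
      exact hi.le
    refine (norm_integral_le_integral_norm (fun y => p y * φ y - g i y * φ y)).trans ?_
    refine le_trans ?_ h2
    refine integral_mono_of_nonneg (Eventually.of_forall fun _ => norm_nonneg _)
      (hp.sub hgi).norm ?_
    filter_upwards [hb] with y hy
    simp only [← sub_mul, norm_mul]
    exact mul_le_of_le_one_right (norm_nonneg _) hy
  obtain ⟨i, hi⟩ := nonempty_interior_of_iUnion_of_closed hE hcover
  obtain ⟨V, hV, hVE⟩ := isOpen_induced_iff.1 (isOpen_interior (s := E i))
  have hmem : ∀ x (hx : x ∈ C ∩ V), (⟨x, hx.1⟩ : C) ∈ E i := fun x hx =>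
    interior_subset (hVE ▸ (show (⟨x, hx.1⟩ : C) ∈ Subtype.val ⁻¹' V from hx.2))
  refine ⟨V, hV, ?_, fun x hx y hy hsing => ?_⟩
  · obtain ⟨x, hx⟩ := hi
    rw [← hVE] at hx
    exact ⟨x, x.2, hx⟩
  · obtain ⟨φ, hφ, hlt⟩ := exists_half_lt_integral_sub hsing
    have h1 := abs_le.1 (hmem x hx φ hφ)
    have h2 := abs_le.1 (hmem y hy φ hφ)
    simp only at h1 h2
    linarith [h1.1, h2.2]

end Baire

/-! ### Stationary measures -/

section Stationary

variable {X T : Type*} [TopologicalSpace X] [CompactSpace X] [TopologicalSpace.MetrizableSpace X]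
  [MeasurableSpace X] [BorelSpace X]
  [TopologicalSpace T] [SecondCountableTopology T] [MeasurableSpace T] [BorelSpace T]
  {G : X → T → X}

/-- The distribution of the random image of a point with distribution `ν`. -/
noncomputable def randomImage (G : X → T → X) (lam : Measure T) (ν : Measure X) : Measure X :=
  (ν.prod lam).map fun p => G p.1 p.2

theorem randomImage_add (hG : Continuous (fun p : X × T => G p.1 p.2)) (lam : Measure T)
    [IsProbabilityMeasure lam] (ν ν' : Measure X) [IsFiniteMeasure ν] [IsFiniteMeasure ν'] :
    randomImage G lam (ν + ν') = randomImage G lam ν + randomImage G lam ν' := by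
  rw [randomImage, Measure.add_prod, Measure.map_add _ _ hG.measurable]
  rfl

theorem lintegral_randomImage (hG : Continuous (fun p : X × T => G p.1 p.2)) (lam : Measure T)
    [IsProbabilityMeasure lam] (ν : Measure X) {h : X → ℝ≥0∞}
    (hh : Measurable h) :
    ∫⁻ y, h y ∂(randomImage G lam ν) = ∫⁻ x, ∫⁻ t, h (G x t) ∂lam ∂ν := by
  rw [randomImage, lintegral_map hh hG.measurable]
  exact lintegral_prod (fun p : X × T => h (G p.1 p.2)) (hh.comp hG.measurable).aemeasurable

theorem randomImage_apply (hG : Continuous (fun p : X × T => G p.1 p.2)) (lam : Measure T)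
    [IsProbabilityMeasure lam] (ν : Measure X) {A : Set X}
    (hA : MeasurableSet A) :
    randomImage G lam ν A = ∫⁻ x, lam {t | G x t ∈ A} ∂ν := by
  rw [randomImage, Measure.map_apply hG.measurable hA, Measure.prod_apply (hG.measurable hA)]
  rfl

theorem randomImage_univ (hG : Continuous (fun p : X × T => G p.1 p.2)) (lam : Measure T)
    [IsProbabilityMeasure lam] (ν : Measure X) : randomImage G lam ν univ = ν univ := by
  rw [randomImage_apply hG lam ν MeasurableSet.univ]
  simp

theorem randomImage_mono (hG : Continuous (fun p : X × T => G p.1 p.2)) (lam : Measure T)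
    [IsProbabilityMeasure lam] {ν ν' : Measure X}
    (h : ν ≤ ν') : randomImage G lam ν ≤ randomImage G lam ν' := by
  refine Measure.le_iff.2 fun A hA => ?_
  rw [randomImage_apply hG lam ν hA, randomImage_apply hG lam ν' hA]
  exact lintegral_mono' h le_rfl

/-- The subtraction is truncated. Pushing `ν ≤ (ν - ν') + ν'` forward shows that `ν - ν'` is
dominated by its random image; both have the same total mass, so they are equal. -/
theorem randomImage_sub (hG : Continuous (fun p : X × T => G p.1 p.2)) (lam : Measure T)
    [IsProbabilityMeasure lam] {ν ν' : Measure X} [IsFiniteMeasure ν] [IsFiniteMeasure ν']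
    (hν : randomImage G lam ν = ν) (hν' : randomImage G lam ν' = ν') :
    randomImage G lam (ν - ν') = ν - ν' := by
  have h1 : ν ≤ (ν - ν') + ν' := Measure.sub_le_iff_le_add.1 le_rfl
  have h2 := randomImage_mono hG lam h1
  rw [randomImage_add hG, hν, hν'] at h2
  exact (Measure.eq_of_le_of_measure_univ_eq (Measure.sub_le_of_le_add h2)
    (randomImage_univ hG lam _).symm).symm

/-- By stationarity, almost every point of `ν` is sent into the support by almost every parameter,
hence by all of them, the support being closed. The points with this property form a closed set of
full measure, which contains the support. -/
theorem forwardInvariant_support (hG : Continuous (fun p : X × T => G p.1 p.2)) (lam : Measure T)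
    [IsProbabilityMeasure lam] [lam.IsOpenPosMeasure] {ν : Measure X} [IsFiniteMeasure ν]
    (hν : randomImage G lam ν = ν) : ForwardInvariant G ν.support := by
  have hcl : IsClosed ν.support := Measure.isClosed_support
  have h0 : ∫⁻ x, lam {t | G x t ∈ ν.supportᶜ} ∂ν = 0 := by
    rw [← randomImage_apply hG lam ν hcl.measurableSet.compl, hν]
    exact Measure.measure_compl_support
  have hm : Measurable fun x => lam {t | G x t ∈ ν.supportᶜ} :=
    measurable_measure_prodMk_left (hG.measurable hcl.measurableSet.compl)
  rw [lintegral_eq_zero_iff hm] at h0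
  have hW : IsClosed {x | ∀ t, G x t ∈ ν.support} := by
    rw [ofPred_forall]
    exact isClosed_iInter fun t => hcl.preimage (hG.comp (Continuous.prodMk_left t))
  refine Measure.support_subset_of_isClosed hW ?_
  filter_upwards [h0] with x hx t
  have ho : IsOpen {t | G x t ∈ ν.supportᶜ} :=
    hcl.isOpen_compl.preimage (hG.comp (Continuous.prodMk_right x))
  have he := (ho.measure_eq_zero_iff lam).1 hx
  by_contra hcon
  exact (eq_empty_iff_forall_notMem.1 he t) hcon

/-- A minimal nonempty closed forward invariant set. -/
def IsMinimalInvariant (G : X → T → X) (C : Set X) : Prop :=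
  Minimal (fun C => IsClosed C ∧ C.Nonempty ∧ ForwardInvariant G C) C

theorem IsMinimalInvariant.support_eq (hG : Continuous (fun p : X × T => G p.1 p.2))
    (lam : Measure T) [IsProbabilityMeasure lam] [lam.IsOpenPosMeasure] {C : Set X}
    (hC : IsMinimalInvariant G C) {ν : Measure X} [IsFiniteMeasure ν]
    (hν : randomImage G lam ν = ν) (hne : ν ≠ 0) (hνC : ν Cᶜ = 0) : ν.support = C := by
  have hsub : ν.support ⊆ C := Measure.support_subset_of_isClosed hC.prop.1 (mem_ae_iff.2 hνC)
  exact hsub.antisymm (hC.le_of_le ⟨Measure.isClosed_support, Measure.nonempty_support hne,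
    forwardInvariant_support hG lam hν⟩ hsub)

/-- The distribution of the position at time `j` of the random orbit of `x`. -/
noncomputable def orbitLaw (G : X → T → X) (lam : Measure T) (j : ℕ) (x : X) : Measure X :=
  (seqMeasure lam).map fun s => randomOrbit G s j x

theorem isProbabilityMeasure_orbitLaw (hG : Continuous (fun p : X × T => G p.1 p.2))
    (lam : Measure T) [IsProbabilityMeasure lam] (j : ℕ) (x : X) :
    IsProbabilityMeasure (orbitLaw G lam j x) :=
  Measure.isProbabilityMeasure_map (continuous_randomOrbit_right hG j x).measurable.aemeasurable

theorem orbitLaw_apply (hG : Continuous (fun p : X × T => G p.1 p.2)) (lam : Measure T)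
    [IsProbabilityMeasure lam] (j : ℕ) (x : X) {A : Set X} (hA : MeasurableSet A) :
    orbitLaw G lam j x A = seqMeasure lam {s | randomOrbit G s j x ∈ A} := by
  rw [orbitLaw, Measure.map_apply (continuous_randomOrbit_right hG j x).measurable hA]
  rfl

theorem measurable_orbitLaw_apply (hG : Continuous (fun p : X × T => G p.1 p.2)) (lam : Measure T)
    [IsProbabilityMeasure lam] (j : ℕ) {A : Set X} (hA : MeasurableSet A) :
    Measurable fun x => orbitLaw G lam j x A := by
  simp only [orbitLaw_apply hG lam j _ hA]
  exact measurable_measure_prodMk_left ((continuous_randomOrbit hG j).measurable hA)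

theorem continuous_integral_orbitLaw (hG : Continuous (fun p : X × T => G p.1 p.2))
    (lam : Measure T) [IsProbabilityMeasure lam] (j : ℕ) (φ : C(X, ℝ)) :
    Continuous fun x => ∫ y, φ y ∂(orbitLaw G lam j x) := by
  have h : ∀ x, ∫ y, φ y ∂(orbitLaw G lam j x) =
      ∫ s, φ (randomOrbit G s j x) ∂(seqMeasure lam) := fun x =>
    integral_map (continuous_randomOrbit_right hG j x).measurable.aemeasurable
      φ.continuous.aestronglyMeasurable
  simp only [h]
  refine continuous_of_dominated (bound := fun _ => ‖φ‖) (fun x => ?_) (fun x => ?_)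
    (integrable_const _) ?_
  · exact (φ.continuous.comp (continuous_randomOrbit_right hG j x)).aestronglyMeasurable
  · exact Eventually.of_forall fun s => φ.norm_coe_le_norm _
  · exact Eventually.of_forall fun s => φ.continuous.comp (continuous_randomOrbit_left hG j s)

theorem lintegral_orbitLaw_of_stationary (hG : Continuous (fun p : X × T => G p.1 p.2))
    (lam : Measure T) [IsProbabilityMeasure lam] {ν : Measure X}
    (hν : randomImage G lam ν = ν) (j : ℕ) {A : Set X} (hA : MeasurableSet A) :
    ∫⁻ x, orbitLaw G lam j x A ∂ν = ν A := by
  induction j with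
  | zero =>
    have h : ∀ x, orbitLaw G lam 0 x A = A.indicator 1 x := fun x => by
      rw [orbitLaw_apply hG lam 0 x hA]
      by_cases hx : x ∈ A <;> simp [randomOrbit, hx]
    simp only [h]
    exact lintegral_indicator_one hA
  | succ j ih =>
    have h : ∀ x, orbitLaw G lam (j + 1) x A = ∫⁻ t, orbitLaw G lam j (G x t) A ∂lam := fun x => by
      rw [orbitLaw_apply hG lam (j + 1) x hA, seqMeasure_apply_prepend lam
        (A := {s | randomOrbit G s (j + 1) x ∈ A})
        ((continuous_randomOrbit_right hG (j + 1) x).measurable hA)]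
      simp only [orbitLaw_apply hG lam j _ hA, mem_ofPred_eq, randomOrbit_prepend]
    simp only [h]
    rw [← lintegral_randomImage hG lam ν (measurable_orbitLaw_apply hG lam j hA), hν, ih]

/-- If the measures differ, both truncated differences are nonzero, stationary, mutually singular
and, by minimality, have support `C`. This transfers singularity to two laws `orbitLaw G lam K` at
points of `C` that can be chosen where Baire's theorem forbids it. -/
theorem IsMinimalInvariant.stationary_unique (hG : Continuous (fun p : X × T => G p.1 p.2))
    (lam : Measure T) [IsProbabilityMeasure lam] [lam.IsOpenPosMeasure] {C : Set X}
    (hC : IsMinimalInvariant G C) {m : Measure X} [IsFiniteMeasure m] {K : ℕ}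
    (hac : ∀ x, orbitLaw G lam K x ≪ m) {ν ν' : Measure X} [IsProbabilityMeasure ν]
    [IsProbabilityMeasure ν'] (hν : randomImage G lam ν = ν) (hν' : randomImage G lam ν' = ν')
    (hνC : ν Cᶜ = 0) (hνC' : ν' Cᶜ = 0) : ν = ν' := by
  by_contra hne
  have hα0 : ν - ν' ≠ 0 := fun h0 => hne <| Measure.eq_of_le_of_isProbabilityMeasure <| by
    have h1 : ν ≤ (ν - ν') + ν' := Measure.sub_le_iff_le_add.1 le_rfl
    rwa [h0, zero_add] at h1
  have hβ0 : ν' - ν ≠ 0 := fun h0 => hne <| Eq.symm <| Measure.eq_of_le_of_isProbabilityMeasure <| by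
    have h1 : ν' ≤ (ν' - ν) + ν := Measure.sub_le_iff_le_add.1 le_rfl
    rwa [h0, zero_add] at h1
  have := isProbabilityMeasure_orbitLaw hG lam K
  obtain ⟨V, hV, hVne, hns⟩ := exists_isOpen_not_mutuallySingular
    (continuous_integral_orbitLaw hG lam K) hac hC.prop.1 hC.prop.2.1
  -- By stationarity, an `α`-null set is null for the law from almost every point for `α`; since `α`
  -- has support `C`, it charges `V`, so such a point exists in `C ∩ V`.
  have key : ∀ α : Measure X, IsFiniteMeasure α → randomImage G lam α = α → α ≠ 0 → α Cᶜ = 0 →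
      ∀ A, MeasurableSet A → α A = 0 → ∃ x ∈ C ∩ V, orbitLaw G lam K x A = 0 := by
    intro α hfin hα hα0 hαC A hA hαA
    have h0 := lintegral_orbitLaw_of_stationary hG lam hα K hA
    rw [hαA, lintegral_eq_zero_iff (measurable_orbitLaw_apply hG lam K hA)] at h0
    have hsupp := hC.support_eq hG lam hα hα0 hαC
    obtain ⟨z, hzC, hzV⟩ := hVne
    have hpos : 0 < α V := by
      rw [← hsupp, Measure.mem_support_iff_forall] at hzC
      exact hzC V (hV.mem_nhds hzV)
    have hfreq : ∃ᵐ x ∂α, x ∈ V := frequently_ae_mem_iff.2 hpos.ne'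
    have hC' : ∀ᵐ x ∂α, x ∈ C := mem_ae_iff.2 hαC
    obtain ⟨x, hxV, hxC, hx⟩ := (hfreq.and_eventually (hC'.and h0)).exists
    exact ⟨x, ⟨hxC, hxV⟩, hx⟩
  obtain ⟨A, hA, hαA, hβA⟩  := Measure.mutually_singular_measure_sub (μ := ν) (ν := ν')
  obtain ⟨x, hx, hxA⟩ := key _ inferInstance (randomImage_sub hG lam hν hν') hα0
    (le_antisymm ((Measure.le_iff'.1 Measure.sub_le _).trans hνC.le) bot_le) A hA hαA
  obtain ⟨y, hy, hyA⟩ := key _ inferInstance (randomImage_sub hG lam hν' hν) hβ0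
    (le_antisymm ((Measure.le_iff'.1 Measure.sub_le _).trans hνC'.le) bot_le) Aᶜ hA.compl hβA
  exact hns x hx y hy ⟨A, hA, hxA, hyA⟩

end Stationary

/-! ### Limits of empirical measures and unique ergodicity of minimal sets -/

section Limits

variable {X T : Type*} [TopologicalSpace X] [CompactSpace X] [TopologicalSpace.MetrizableSpace X]
  [MeasurableSpace X] [BorelSpace X]
  [TopologicalSpace T] [SecondCountableTopology T] [MeasurableSpace T] [BorelSpace T]
  {G : X → T → X}

theorem measure_eq_of_forall_integral_eq {ν ν' : Measure X} [IsFiniteMeasure ν] [IsFiniteMeasure ν']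
    (h : ∀ φ : C(X, ℝ), ∫ x, φ x ∂ν = ∫ x, φ x ∂ν') : ν = ν' :=
  ext_of_forall_integral_eq_of_IsFiniteMeasure fun φ => h φ.toContinuousMap

theorem integral_transfer (hG : Continuous (fun p : X × T => G p.1 p.2)) (lam : Measure T)
    [IsProbabilityMeasure lam] (ν : Measure X) [IsFiniteMeasure ν] (φ : C(X, ℝ)) :
    ∫ x, transfer hG lam φ x ∂ν = ∫ y, φ y ∂(randomImage G lam ν) := by
  rw [randomImage, integral_map hG.measurable.aemeasurable φ.continuous.aestronglyMeasurable]
  exact (integral_prod (fun p : X × T => φ (G p.1 p.2))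
    (Integrable.of_bound (φ.continuous.comp hG).aestronglyMeasurable ‖φ‖
      (Eventually.of_forall fun p => φ.norm_coe_le_norm _))).symm

/-- The uniform distribution on the first `k + 1` terms of a sequence. -/
noncomputable def empirical (u : ℕ → X) (k : ℕ) : ProbabilityMeasure X :=
  ⟨((k + 1 : ℕ) : ℝ≥0∞)⁻¹ • ∑ j ∈ Finset.range (k + 1), Measure.dirac (u j), ⟨by
    simp only [Measure.smul_apply, Measure.finsetSum_apply, measure_univ, Finset.sum_const,
      Finset.card_range, nsmul_eq_mul, mul_one, smul_eq_mul]
    exact ENNReal.inv_mul_cancel (by simp) (ENNReal.natCast_ne_top _)⟩⟩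

theorem integral_empirical (u : ℕ → X) (k : ℕ) (φ : C(X, ℝ)) :
    ∫ x, φ x ∂(empirical u k : Measure X) = average φ u (k + 1) := by
  change ∫ x, φ x ∂(((k + 1 : ℕ) : ℝ≥0∞)⁻¹ • ∑ j ∈ Finset.range (k + 1), Measure.dirac (u j)) = _
  rw [integral_smul_measure, integral_finsetSum_measure fun j _ => integrable_continuousMap φ _]
  rw [ENNReal.toReal_inv, ENNReal.toReal_natCast]
  simp [average]

/-- The distance to `C` is a continuous test function that vanishes along the sequence. -/
theorem measure_compl_eq_zero_of_tendsto_average {u : ℕ → X} {C : Set X} (hC : IsClosed C)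
    (hu : ∀ j, u j ∈ C) {l : Filter ℕ} [l.NeBot] {ν : Measure X} [IsProbabilityMeasure ν]
    (h : ∀ φ : C(X, ℝ), Tendsto (fun k => average φ u (k + 1)) l (𝓝 (∫ x, φ x ∂ν))) :
    ν Cᶜ = 0 := by
  let _ := TopologicalSpace.metrizableSpaceMetric X
  set φ : C(X, ℝ) := ⟨fun x => Metric.infDist x C, Metric.continuous_infDist_pt C⟩
  have h0 : ∀ j, φ (u j) = 0 := fun j => Metric.infDist_zero_of_mem (hu j)
  have h1 : ∫ x, φ x ∂ν = 0 := by
    refine tendsto_nhds_unique (h φ) ?_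
    simp [average, h0]
  have h1 := (integral_eq_zero_iff_of_nonneg (f := φ) (fun x => Metric.infDist_nonneg)
    (integrable_continuousMap φ ν)).1 h1
  refine mem_ae_iff.1 ?_
  filter_upwards [h1] with x hx
  exact (hC.mem_iff_infDist_zero ⟨_, hu 0⟩).2 hx

/-- Probability measures on a compact space form a compact space, so the empirical measures converge
along any ultrafilter. The hypothesis `hu` says that the limit does not distinguish `g` from its
transfer. -/
theorem exists_stationary_limit (hG : Continuous (fun p : X × T => G p.1 p.2)) (lam : Measure T)
    [IsProbabilityMeasure lam] {u : ℕ → X}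
    (hu : ∀ g : C(X, ℝ), Tendsto (average (transfer hG lam g - g) u) atTop (𝓝 0))
    {C : Set X} (hC : IsClosed C) (huC : ∀ j, u j ∈ C) (𝒰 : Ultrafilter ℕ)
    (h𝒰 : (𝒰 : Filter ℕ) ≤ atTop) :
    ∃ ν : Measure X, IsProbabilityMeasure ν ∧ randomImage G lam ν = ν ∧ ν Cᶜ = 0 ∧
      ∀ φ : C(X, ℝ), Tendsto (fun k => average φ u (k + 1)) 𝒰 (𝓝 (∫ x, φ x ∂ν)) := by
  obtain ⟨ν, -, hν⟩ := isCompact_univ.ultrafilter_le_nhds (𝒰.map (empirical u)) (by simp)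
  have hlim : ∀ φ : C(X, ℝ),
      Tendsto (fun k => average φ u (k + 1)) 𝒰 (𝓝 (∫ x, φ x ∂(ν : Measure X))) := fun φ => by
    have := ProbabilityMeasure.tendsto_iff_forall_integral_tendsto.1
      (show Tendsto (empirical u) 𝒰 (𝓝 ν) from hν) (BoundedContinuousFunction.mkOfCompact φ)
    exact this.congr fun k => integral_empirical u k φ
  refine ⟨ν, inferInstance, ?_, measure_compl_eq_zero_of_tendsto_average hC huC hlim, hlim⟩
  have : IsProbabilityMeasure (randomImage G lam (ν : Measure X)) :=
    ⟨by rw [randomImage_univ hG]; exact measure_univ⟩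
  refine measure_eq_of_forall_integral_eq fun φ => ?_
  rw [← integral_transfer hG lam]
  have h1 := (hlim (transfer hG lam φ)).sub (hlim φ)
  have h2 : Tendsto (fun k => average (transfer hG lam φ - φ) u (k + 1)) 𝒰 (𝓝 0) :=
    ((tendsto_add_atTop_iff_nat 1).2 (hu φ)).mono_left h𝒰
  simp only [average_sub] at h2
  exact sub_eq_zero.1 (tendsto_nhds_unique h1 h2)

/-- On a minimal set there is a unique stationary measure, and it describes the time averages of
almost all random orbits of all points. -/
theorem IsMinimalInvariant.exists_ae_hasTimeAverages
    (hG : Continuous (fun p : X × T => G p.1 p.2)) (lam : Measure T) [IsProbabilityMeasure lam]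
    [lam.IsOpenPosMeasure] {C : Set X} (hC : IsMinimalInvariant G C) {m : Measure X}
    [IsFiniteMeasure m] {K : ℕ} (hac : ∀ x, orbitLaw G lam K x ≪ m) :
    ∃ ν : Measure X, IsProbabilityMeasure ν ∧ ν Cᶜ = 0 ∧
      ∀ x ∈ C, ∀ᵐ s ∂(seqMeasure lam), HasTimeAverages G ν x s := by
  obtain ⟨x₀, hx₀⟩ := hC.prop.2.1
  have hmem : ∀ x ∈ C, ∀ (s : ℕ → T) j, randomOrbit G s j x ∈ C := fun x hx s j =>
    hC.prop.2.2.randomOrbit_mem hx s j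
  obtain ⟨s₀, hs₀⟩ := (ae_tendsto_average_transfer_sub hG lam x₀).exists
  obtain ⟨ν, hνp, hν, hνC, -⟩ := exists_stationary_limit hG lam hs₀ hC.prop.1 (hmem x₀ hx₀ s₀)
    (hyperfilter ℕ) Nat.hyperfilter_le_atTop
  refine ⟨ν, hνp, hνC, fun x hx => ?_⟩
  filter_upwards [ae_tendsto_average_transfer_sub hG lam x] with s hs φ
  -- Convergence is tested along ultrafilters: each limit is a stationary measure carried by `C`,
  -- hence equal to `ν`. The shift by one avoids the empty average.
  rw [← tendsto_add_atTop_iff_nat 1, tendsto_iff_ultrafilter]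
  intro 𝒰 h𝒰
  obtain ⟨ν', hνp', hν', hνC', hlim⟩ := exists_stationary_limit hG lam hs hC.prop.1 (hmem x hx s) 𝒰 h𝒰
  rw [hC.stationary_unique hG lam hac hν hν' hνC hνC']
  exact hlim φ

end Limits

/-! ### Minimal sets -/

section Minimal

theorem exists_isMinimalInvariant_subset {X T : Type*} [TopologicalSpace X] [CompactSpace X]
    {G : X → T → X} {Y : Set X} (hY : IsClosed Y) (hne : Y.Nonempty)
    (hinv : ForwardInvariant G Y) : ∃ C ⊆ Y, IsMinimalInvariant G C := by
  refine zorn_superset_nonempty {C | IsClosed C ∧ C.Nonempty ∧ ForwardInvariant G C}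
    (fun c hc hchain hcne => ?_) Y ⟨hY, hne, hinv⟩
  refine ⟨⋂₀ c, ⟨isClosed_sInter fun s hs => (hc hs).1, ?_, fun x hx t => ?_⟩,
    fun s hs => sInter_subset_of_mem hs⟩
  · have : Nonempty c := hcne.to_subtype
    rw [sInter_eq_iInter]
    refine IsCompact.nonempty_iInter_of_directed_nonempty_isCompact_isClosed _ ?_
      (fun s => (hc s.2).2.1) (fun s => (hc s.2).1.isCompact) (fun s => (hc s.2).1)
    intro s s'
    rcases hchain.total s.2 s'.2 with h | h
    · exact ⟨s, Subset.rfl, h⟩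
    · exact ⟨s', h, Subset.rfl⟩
  · exact mem_sInter.2 fun s hs => (hc hs).2.2 x (mem_sInter.1 hx s hs) t

theorem IsMinimalInvariant.eq_of_inter_nonempty {X T : Type*} [TopologicalSpace X]
    {G : X → T → X} {C C' : Set X} (hC : IsMinimalInvariant G C) (hC' : IsMinimalInvariant G C')
    (h : (C ∩ C').Nonempty) : C = C' := by
  have hp : IsClosed (C ∩ C') ∧ (C ∩ C').Nonempty ∧ ForwardInvariant G (C ∩ C') :=
    ⟨hC.prop.1.inter hC'.prop.1, h, fun x hx t =>
      ⟨hC.prop.2.2 x hx.1 t, hC'.prop.2.2 x hx.2 t⟩⟩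
  exact ((hC.eq_of_subset hp inter_subset_left).symm).trans
    (hC'.eq_of_subset hp inter_subset_right)

variable {X T : Type*} [EMetricSpace X] [CompactSpace X] {G : X → T → X}

theorem IsMinimalInvariant.exists_eball_subset {ξ : ℝ≥0∞}
    (hball : ∀ x, ∃ y, Metric.eball y ξ ⊆ reachable G x) {C : Set X}
    (hC : IsMinimalInvariant G C) : ∃ y, Metric.eball y ξ ⊆ C := by
  obtain ⟨x, hx⟩ := hC.prop.2.1
  obtain ⟨y, hy⟩ := hball x
  refine ⟨y, hy.trans ?_⟩
  rintro _ ⟨s, j, rfl⟩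
  exact hC.prop.2.2.randomOrbit_mem hx s j

/-- Cover the space by finitely many balls of radius `ξ / 2`, and assign to each minimal set one
that contains the centre of a `ξ`-ball inside it. Two sets with the same assignment have centres
closer than `ξ`, so they meet and coincide. -/
theorem finite_setOf_isMinimalInvariant {ξ : ℝ≥0∞} (hξ : 0 < ξ)
    (hball : ∀ x, ∃ y, Metric.eball y ξ ⊆ reachable G x) :
    {C | IsMinimalInvariant G C}.Finite := by
  have hξ' : 0 < ξ / 2 := ENNReal.half_pos hξ.ne'
  obtain ⟨t, -, ht⟩ := isCompact_univ.elim_nhds_subcover (fun z : X => Metric.eball z (ξ / 2))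
    fun z _ => Metric.eball_mem_nhds z hξ'
  have h : ∀ C : {C | IsMinimalInvariant G C}, ∃ z : t,
      ∃ y, y ∈ Metric.eball (z : X) (ξ / 2) ∧ Metric.eball y ξ ⊆ (C : Set X) := fun C => by
    obtain ⟨y, hy⟩ := IsMinimalInvariant.exists_eball_subset hball C.2
    obtain ⟨z, hz, hyz⟩ := mem_iUnion₂.1 (ht (mem_univ y))
    exact ⟨⟨z, hz⟩, y, hyz, hy⟩
  choose z hz using h
  refine Set.finite_coe_iff.1 (Finite.of_injective z fun C C' hzz => Subtype.ext ?_)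
  obtain ⟨y, hy, hyC⟩ := hz C
  obtain ⟨y', hy', hyC'⟩ := hz C'
  refine IsMinimalInvariant.eq_of_inter_nonempty C.2 C'.2
    ⟨y', hyC ?_, hyC' (Metric.mem_eball_self hξ)⟩
  rw [← hzz] at hy'
  calc edist y' y ≤ edist y' (z C) + edist y (z C) := edist_triangle_right _ _ _
    _ < ξ / 2 + ξ / 2 := ENNReal.add_lt_add hy' hy
    _ = ξ := ENNReal.add_halves ξ

end Minimal

/-! ### Finitely many physical measures, and the distribution of random orbits among them -/

section Decomposition

variable {X T : Type*} [EMetricSpace X] [CompactSpace X] [MeasurableSpace X] [BorelSpace X]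
  [TopologicalSpace T] [SecondCountableTopology T] [MeasurableSpace T] [BorelSpace T]
  {G : X → T → X}

theorem integrable_average_randomOrbit (hG : Continuous (fun p : X × T => G p.1 p.2))
    (lam : Measure T) [IsProbabilityMeasure lam] (φ : C(X, ℝ)) (x : X) (n : ℕ) :
    Integrable (fun s => average φ (fun j => randomOrbit G s j x) n) (seqMeasure lam) :=
  Integrable.of_bound (continuous_const.mul (continuous_finsetSum _ fun j _ =>
    φ.continuous.comp (continuous_randomOrbit_right hG j x))).aestronglyMeasurable ‖φ‖
    (Eventually.of_forall fun _ => abs_average_le φ _ n)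

theorem tendsto_integral_average (hG : Continuous (fun p : X × T => G p.1 p.2))
    (lam : Measure T) [IsProbabilityMeasure lam] (φ : C(X, ℝ)) (x : X) {L : (ℕ → T) → ℝ}
    (h : ∀ᵐ s ∂(seqMeasure lam),
      Tendsto (average φ fun j => randomOrbit G s j x) atTop (𝓝 (L s))) :
    Tendsto (fun n => ∫ s, average φ (fun j => randomOrbit G s j x) n ∂(seqMeasure lam)) atTop
      (𝓝 (∫ s, L s ∂(seqMeasure lam))) :=
  tendsto_integral_of_dominated_convergence (fun _ => ‖φ‖)
    (fun n => (integrable_average_randomOrbit hG lam φ x n).aestronglyMeasurable)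
    (integrable_const _) (fun n => Eventually.of_forall fun _ => abs_average_le φ _ n) h

theorem eq_of_hasTimeAverages {ν ν' : Measure X} [IsProbabilityMeasure ν] [IsProbabilityMeasure ν']
    {x : X} {s : ℕ → T} (h : HasTimeAverages G ν x s) (h' : HasTimeAverages G ν' x s) : ν = ν' :=
  measure_eq_of_forall_integral_eq fun φ => tendsto_nhds_unique (h φ) (h' φ)

/-- A random family whose orbits spread over balls of a fixed radius and have distributions with
densities admits only finitely many physical measures, and the random orbits of each point are
distributed among them. -/
theorem exists_physical_decomposition (hG : Continuous (fun p : X × T => G p.1 p.2))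
    (lam : Measure T) [IsProbabilityMeasure lam] [lam.IsOpenPosMeasure] {m : Measure X}
    [IsFiniteMeasure m] {K : ℕ} (hac : ∀ x, orbitLaw G lam K x ≪ m) {ξ : ℝ≥0∞} (hξ : 0 < ξ)
    (hball : ∀ x, ∃ y, Metric.eball y ξ ⊆ reachable G x) :
    ∃ (l : ℕ) (ν : Fin l → Measure X) (p : Fin l → X → ℝ),
      (∀ k, IsProbabilityMeasure (ν k)) ∧ Function.Injective ν ∧ (∀ k, Measurable (p k)) ∧
      (∀ k x, 0 ≤ p k x) ∧ (∀ x, ∑ k, p k x = 1) ∧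
      (∀ x (φ : C(X, ℝ)), Tendsto
        (fun n => ∫ s, average φ (fun j => randomOrbit G s j x) n ∂(seqMeasure lam)) atTop
        (𝓝 (∑ k, p k x * ∫ y, φ y ∂(ν k)))) ∧
      (∀ k, 0 < m {x | ∀ᵐ s ∂(seqMeasure lam), HasTimeAverages G (ν k) x s}) ∧
      ∀ (ρ : Measure X) (x : X), IsProbabilityMeasure ρ →
        (∀ᵐ s ∂(seqMeasure lam), HasTimeAverages G ρ x s) → ∃ k, ρ = ν k := by
  classical
  obtain ⟨t₀⟩ := nonempty_of_isProbabilityMeasure lam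
  have hfin := finite_setOf_isMinimalInvariant hξ hball
  obtain ⟨l, C, hCinj, hCrange⟩ := hfin.fin_param
  have hC : ∀ k, IsMinimalInvariant G (C k) := fun k => by
    have : C k ∈ range C := mem_range_self k
    rwa [hCrange] at this
  choose ν hνp hνC hνt using fun k => (hC k).exists_ae_hasTimeAverages hG lam hac
  have hmC : ∀ k, MeasurableSet (C k) := fun k => (hC k).prop.1.measurableSet
  have hdisj : ∀ {k k' x}, x ∈ C k → x ∈ C k' → k = k' := fun {k k' x} h h' =>
    hCinj ((hC k).eq_of_inter_nonempty (hC k') ⟨x, h, h'⟩)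
  have hνinj : Function.Injective ν := fun k k' hkk' => by
    by_contra hne
    have h1 : C k ∩ C k' = ∅ := eq_empty_of_forall_notMem fun x hx => hne (hdisj hx.1 hx.2)
    have h2 : ν k (C k ∩ C k')ᶜ = 0 := by
      rw [compl_inter]
      exact measure_union_null (hνC k) (hkk' ▸ hνC k')
    rw [h1, compl_empty, measure_univ] at h2
    exact one_ne_zero h2
  -- The closure of the set reached from `y` contains a minimal set. That set has interior points,
  -- and its interior, being open, meets the reached set itself.
  have hhit : ∀ x, ∀ᵐ s ∂(seqMeasure lam), ∃ j, randomOrbit G s j x ∈ ⋃ k, interior (C k) := by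
    intro x
    refine ae_exists_randomOrbit_mem hG lam (isOpen_iUnion fun k => isOpen_interior) isClosed_univ
      (fun _ _ _ => mem_univ _) (fun y _ => ?_) (mem_univ x)
    obtain ⟨D, hD, hDmin⟩ := exists_isMinimalInvariant_subset (G := G)
      (isClosed_closure (s := reachable G y)) ⟨y, subset_closure ⟨fun _ => t₀, 0, rfl⟩⟩
      ((forwardInvariant_reachable G y).closure hG)
    obtain ⟨k, rfl⟩ : D ∈ range C := hCrange ▸ hDmin
    obtain ⟨z, hz⟩ := (hC k).exists_eball_subset hball
    have hzi : z ∈ interior (C k) := mem_interior_iff_mem_nhds.2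
      (mem_of_superset (Metric.eball_mem_nhds z hξ) hz)
    obtain ⟨w, hw, hw'⟩ := mem_closure_iff.1 (hD (interior_subset hzi)) _ isOpen_interior hzi
    exact ⟨w, hw', mem_iUnion.2 ⟨k, hw⟩⟩
  have htrans : ∀ x, ∀ᵐ s ∂(seqMeasure lam), ∀ k j, randomOrbit G s j x ∈ C k →
      HasTimeAverages G (ν k) x s := fun x =>
    ae_all_iff.2 fun k => ae_all_iff.2 fun j =>
      ae_hasTimeAverages_of_randomOrbit_mem hG lam (ν k) (hmC k) (hνt k) j x
  -- The event of ever entering `C k`. Minimal sets are disjoint and never left, so almost surely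
  -- exactly one of these events occurs.
  set E : Fin l → X → Set (ℕ → T) := fun k x => {s | ∃ j, randomOrbit G s j x ∈ C k}
  have hE : ∀ k, MeasurableSet {q : X × (ℕ → T) | ∃ j, randomOrbit G q.2 j q.1 ∈ C k} := fun k => by
    rw [ofPred_exists]
    exact MeasurableSet.iUnion fun j => (continuous_randomOrbit hG j).measurable (hmC k)
  have hEx : ∀ k x, MeasurableSet (E k x) := fun k x => measurable_prodMk_left (hE k)
  set p : Fin l → X → ℝ := fun k x => (seqMeasure lam).real (E k x)
  have hconv : ∀ x (φ : C(X, ℝ)), Tendsto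
      (fun n => ∫ s, average φ (fun j => randomOrbit G s j x) n ∂(seqMeasure lam)) atTop
      (𝓝 (∑ k, p k x * ∫ y, φ y ∂(ν k))) := by
    intro x φ
    have h1 := tendsto_integral_average hG lam φ x
      (L := fun s => ∑ k, (E k x).indicator (fun _ => ∫ y, φ y ∂(ν k)) s) ?_
    · rw [integral_finsetSum _ fun k _ => (integrable_const _).indicator (hEx k x)] at h1
      simpa [integral_indicator_const _ (hEx _ x), p] using h1
    · filter_upwards [hhit x, htrans x] with s ⟨j, hj⟩ hs
      obtain ⟨k, hk⟩ := mem_iUnion.1 hj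
      have hkC := interior_subset hk
      rw [Finset.sum_eq_single k]
      · rw [indicator_of_mem (show s ∈ E k x from ⟨j, hkC⟩)]
        exact hs k j hkC φ
      · intro k' _ hne
        refine indicator_of_notMem (fun h => hne ?_) _
        obtain ⟨j', hj'⟩ := h
        exact hdisj ((hC k').prop.2.2.randomOrbit_mem_of_le (le_max_left j' j) hj')
          ((hC k).prop.2.2.randomOrbit_mem_of_le (le_max_right j' j) hkC)
      · exact fun h => (h (Finset.mem_univ k)).elim
  refine ⟨l, ν, p, hνp, hνinj, fun k => ?_, fun k x => measureReal_nonneg, fun x => ?_, hconv,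
    fun k => ?_, fun ρ x hρ hx => ?_⟩
  · exact (measurable_measure_prodMk_left (hE k)).ennreal_toReal
  -- The weights sum to one by testing the convergence on the constant `1`; the empty average, which
  -- is `0`, must be left out.
  · have h1 := hconv x 1
    simp only [ContinuousMap.one_apply, integral_const, probReal_univ, smul_eq_mul, mul_one] at h1
    refine tendsto_nhds_unique h1 (tendsto_const_nhds.congr' ?_)
    filter_upwards [eventually_gt_atTop 0] with n hn
    have : (n : ℝ) ≠ 0 := by exact_mod_cast hn.ne'
    simp [average, this]
  -- The law at time `K` from a point of `C k` is carried by `C k` and absolutely continuous, so `m`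
  -- charges `C k`.
  · obtain ⟨x, hx⟩ := (hC k).prop.2.1
    have h1 : orbitLaw G lam K x (C k) = 1 := by
      have := isProbabilityMeasure_orbitLaw hG lam K x
      rw [orbitLaw_apply hG lam K x (hmC k), ← measure_univ (μ := seqMeasure lam)]
      congr 1
      exact eq_univ_of_forall fun s => (hC k).prop.2.2.randomOrbit_mem hx s K
    have h2 : m (C k) ≠ 0 := fun h0 => by
      rw [hac x h0] at h1
      exact zero_ne_one h1
    exact (pos_iff_ne_zero.2 h2).trans_le (measure_mono fun y hy => hνt k y hy)
  · obtain ⟨s, ⟨⟨j, hj⟩, hs⟩, hρs⟩ := ((hhit x).and (htrans x)).and hx |>.exists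
    obtain ⟨k, hk⟩ := mem_iUnion.1 hj
    exact ⟨k, eq_of_hasTimeAverages hρs (hs k j (interior_subset hk))⟩

end Decomposition

/-! ### The noise as a measure on a closed ball -/

section Noise

/-- The closed ball of radius `ε`, as the space of parameters at noise level `ε`. -/
abbrev NoiseBall (n : ℕ) (ε : ℝ) : Type :=
  Metric.closedBall (0 : EuclideanSpace ℝ (Fin n)) ε

/-- The noise, as a measure on the closed ball. -/
noncomputable def ballNoise (n : ℕ) (ε : ℝ) : Measure (NoiseBall n ε) :=
  (noise n ε).comap Subtype.val

theorem measurableEmbedding_noiseBall (n : ℕ) (ε : ℝ) :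
    MeasurableEmbedding (Subtype.val : NoiseBall n ε → EuclideanSpace ℝ (Fin n)) :=
  MeasurableEmbedding.subtype_coe Metric.isClosed_closedBall.measurableSet

theorem map_ballNoise (n : ℕ) (ε : ℝ) : (ballNoise n ε).map Subtype.val = noise n ε := by
  rw [ballNoise, (measurableEmbedding_noiseBall n ε).map_comap, Subtype.range_coe]
  simp only [noise, Measure.restrict_smul]
  rw [Measure.restrict_restrict Metric.isClosed_closedBall.measurableSet, inter_self]

theorem isProbabilityMeasure_ballNoise (n : ℕ) {ε : ℝ} (hε : 0 < ε) :
    IsProbabilityMeasure (ballNoise n ε) := by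
  have h := isProbabilityMeasure_noise n hε
  refine ⟨?_⟩
  have h1 := measure_univ (μ := noise n ε)
  rw [← map_ballNoise, Measure.map_apply measurable_subtype_coe MeasurableSet.univ] at h1
  exact h1

/-- A nonempty relatively open subset of the closed ball meets the open ball, even if it is given by
a boundary point. -/
theorem isOpenPosMeasure_ballNoise (n : ℕ) {ε : ℝ} (hε : 0 < ε) :
    (ballNoise n ε).IsOpenPosMeasure := by
  refine ⟨fun U hU hne => ?_⟩
  obtain ⟨V, hV, rfl⟩ := isOpen_induced_iff.1 hU
  obtain ⟨x, hx⟩ := hne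
  have hxc : (x : EuclideanSpace ℝ (Fin n)) ∈ closure (Metric.ball 0 ε) := by
    rw [closure_ball _ hε.ne']
    exact x.2
  obtain ⟨y, hyV, hyb⟩ := mem_closure_iff.1 hxc V hV hx
  have hpos : 0 < volume (V ∩ Metric.ball (0 : EuclideanSpace ℝ (Fin n)) ε) :=
    (hV.inter Metric.isOpen_ball).measure_pos volume ⟨y, hyV, hyb⟩
  have h1 : ballNoise n ε (Subtype.val ⁻¹' V) = noise n ε V := by
    rw [← map_ballNoise, (measurableEmbedding_noiseBall n ε).map_apply]
  rw [h1]
  simp only [noise, Measure.smul_apply, smul_eq_mul]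
  rw [Measure.restrict_apply hV.measurableSet]
  refine mul_ne_zero (ENNReal.inv_ne_zero.2 measure_closedBall_lt_top.ne) ?_
  exact (hpos.trans_le (measure_mono (inter_subset_inter_right _ Metric.ball_subset_closedBall))).ne'

/-- A sequence in the closed ball, as a sequence of parameters. -/
def coeSeq {n : ℕ} {ε : ℝ} (s : ℕ → NoiseBall n ε) : ℕ → EuclideanSpace ℝ (Fin n) :=
  fun j => s j

theorem measurableEmbedding_coeSeq (n : ℕ) (ε : ℝ) :
    MeasurableEmbedding (coeSeq : (ℕ → NoiseBall n ε) → ℕ → EuclideanSpace ℝ (Fin n)) := by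
  refine Topology.IsClosedEmbedding.measurableEmbedding
    (Continuous.isClosedEmbedding ?_ fun s s' h => ?_)
  · exact continuous_pi fun j => continuous_subtype_val.comp (continuous_apply j)
  · exact funext fun j => Subtype.ext (congrFun h j)

theorem map_coeSeq (n : ℕ) {ε : ℝ} (hε : 0 < ε) :
    (seqMeasure (ballNoise n ε)).map coeSeq = noiseSeq n ε := by
  have := isProbabilityMeasure_ballNoise n hε
  have h := Measure.infinitePi_map_pi (μ := fun _ : ℕ => ballNoise n ε)
    (f := fun _ => Subtype.val) (fun _ => measurable_subtype_coe)
  rw [noiseSeq]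
  simp only [map_ballNoise] at h
  exact h

/-- The inclusion of sequences is a measurable embedding, so no measurability of `p` is needed. -/
theorem ae_noiseSeq_iff (n : ℕ) {ε : ℝ} (hε : 0 < ε) {p : (ℕ → EuclideanSpace ℝ (Fin n)) → Prop} :
    (∀ᵐ t ∂(noiseSeq n ε), p t) ↔ ∀ᵐ s ∂(seqMeasure (ballNoise n ε)), p (coeSeq s) := by
  rw [← map_coeSeq n hε, (measurableEmbedding_coeSeq n ε).ae_map_iff]

theorem coeSeq_mem_perturbationSpace {n : ℕ} {ε : ℝ} (s : ℕ → NoiseBall n ε) :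
    coeSeq s ∈ perturbationSpace n ε := fun j => mem_closedBall_zero_iff.1 (s j).2

theorem exists_coeSeq_eq {n : ℕ} {ε : ℝ} {t : ℕ → EuclideanSpace ℝ (Fin n)}
    (ht : t ∈ perturbationSpace n ε) : ∃ s : ℕ → NoiseBall n ε, coeSeq s = t :=
  ⟨fun j => ⟨t j, mem_closedBall_zero_iff.2 (ht j)⟩, rfl⟩

end Noise

/-! ### Translation between parameters in Euclidean space and in the closed ball -/

section Restrict

variable {M : Type*} {n : ℕ}

/-- The family of maps with parameters in the closed ball of radius `ε`. -/
def restrictFamily (F : M → EuclideanSpace ℝ (Fin n) → M) (ε : ℝ) : M → NoiseBall n ε → M :=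
  fun x t => F x t

theorem iter_coeSeq (F : M → EuclideanSpace ℝ (Fin n) → M) {ε : ℝ} (s : ℕ → NoiseBall n ε) (j : ℕ)
    (x : M) : iter F (coeSeq s) j x = randomOrbit (restrictFamily F ε) s j x := by
  induction j with
  | zero => rfl
  | succ j ih => rw [iter, randomOrbit, ih]; rfl

theorem timeAveragesTo_coeSeq [TopologicalSpace M] [MeasurableSpace M]
    (F : M → EuclideanSpace ℝ (Fin n) → M) {ε : ℝ} (s : ℕ → NoiseBall n ε) (x : M) (ρ : Measure M) :
    TimeAveragesTo F x (coeSeq s) ρ ↔ HasTimeAverages (restrictFamily F ε) ρ x s := by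
  simp only [TimeAveragesTo, HasTimeAverages, iter_coeSeq]
  rfl

theorem ae_timeAveragesTo_iff [TopologicalSpace M] [MeasurableSpace M]
    (F : M → EuclideanSpace ℝ (Fin n) → M) {ε : ℝ} (hε : 0 < ε) (x : M) (ρ : Measure M) :
    (∀ᵐ t ∂(noiseSeq n ε), TimeAveragesTo F x t ρ) ↔
      ∀ᵐ s ∂(seqMeasure (ballNoise n ε)), HasTimeAverages (restrictFamily F ε) ρ x s := by
  rw [ae_noiseSeq_iff n hε]
  simp only [timeAveragesTo_coeSeq]

theorem continuous_restrictFamily [TopologicalSpace M] {F : M → EuclideanSpace ℝ (Fin n) → M}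
    (hF : ContinuousOn (fun p : M × EuclideanSpace ℝ (Fin n) => F p.1 p.2)
      (univ ×ˢ Metric.ball 0 1)) {ε : ℝ} (hε : ε < 1) :
    Continuous (fun p : M × NoiseBall n ε => restrictFamily F ε p.1 p.2) := by
  refine hF.comp_continuous (f := fun p : M × NoiseBall n ε => (p.1, (p.2 : EuclideanSpace ℝ (Fin n))))
    (by fun_prop) fun p => ⟨mem_univ _, ?_⟩
  exact Metric.closedBall_subset_ball hε p.2.2

variable [EMetricSpace M] [CompactSpace M] [MeasurableSpace M] [BorelSpace M]

theorem map_iter_noiseSeq (F : M → EuclideanSpace ℝ (Fin n) → M)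
    (hF : ContinuousOn (fun p : M × EuclideanSpace ℝ (Fin n) => F p.1 p.2)
      (univ ×ˢ Metric.ball 0 1)) {ε : ℝ} (hε : 0 < ε) (hε1 : ε < 1) (j : ℕ) (x : M) :
    (noiseSeq n ε).map (fun t => iter F t j x) =
      orbitLaw (restrictFamily F ε) (ballNoise n ε) j x := by
  have hG := continuous_restrictFamily hF hε1
  have h1 : (fun t => iter F t j x) ∘ coeSeq (ε := ε) =
      fun s => randomOrbit (restrictFamily F ε) s j x := funext fun s => iter_coeSeq F s j x
  -- The family is unconstrained outside the unit ball, so only almost everywhere measurability is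
  -- available. It is what keeps `Measure.map` from taking its default value zero.
  have hae : AEMeasurable (fun t => iter F t j x) ((seqMeasure (ballNoise n ε)).map coeSeq) := by
    rw [(measurableEmbedding_coeSeq n ε).aemeasurable_map_iff, h1]
    exact (continuous_randomOrbit_right hG j x).measurable.aemeasurable
  rw [← map_coeSeq n hε, AEMeasurable.map_map_of_aemeasurable hae
    (measurableEmbedding_coeSeq n ε).measurable.aemeasurable, h1]
  rfl

theorem map_prod_iter_noiseSeq (F : M → EuclideanSpace ℝ (Fin n) → M)
    (hF : ContinuousOn (fun p : M × EuclideanSpace ℝ (Fin n) => F p.1 p.2)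
      (univ ×ˢ Metric.ball 0 1)) {ε : ℝ} (hε : 0 < ε) (hε1 : ε < 1) (j : ℕ) (m : Measure M)
    [IsFiniteMeasure m] :
    (m.prod (noiseSeq n ε)).map (fun p => iter F p.2 j p.1) =
      (m.prod (seqMeasure (ballNoise n ε))).map
        (fun p => randomOrbit (restrictFamily F ε) p.2 j p.1) := by
  have := isProbabilityMeasure_ballNoise n hε
  have hG := continuous_restrictFamily hF hε1
  have he : MeasurableEmbedding (Prod.map (id : M → M) (coeSeq (n := n) (ε := ε))) :=
    MeasurableEmbedding.id.prodMap (measurableEmbedding_coeSeq n ε)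
  have hprod : m.prod (noiseSeq n ε) =
      (m.prod (seqMeasure (ballNoise n ε))).map (Prod.map id coeSeq) := by
    rw [← Measure.map_prod_map _ _ measurable_id (measurableEmbedding_coeSeq n ε).measurable,
      map_coeSeq n hε, Measure.map_id]
  have h1 : (fun p : M × (ℕ → EuclideanSpace ℝ (Fin n)) => iter F p.2 j p.1) ∘
      Prod.map id (coeSeq (ε := ε)) = fun p => randomOrbit (restrictFamily F ε) p.2 j p.1 :=
    funext fun p => iter_coeSeq F p.2 j p.1
  have hae : AEMeasurable (fun p : M × (ℕ → EuclideanSpace ℝ (Fin n)) => iter F p.2 j p.1)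
      ((m.prod (seqMeasure (ballNoise n ε))).map (Prod.map id coeSeq)) := by
    rw [he.aemeasurable_map_iff, h1]
    exact (continuous_randomOrbit hG j).measurable.aemeasurable
  rw [hprod, AEMeasurable.map_map_of_aemeasurable hae he.measurable.aemeasurable, h1]

theorem integral_visitFrequencyAt (F : M → EuclideanSpace ℝ (Fin n) → M)
    (hF : ContinuousOn (fun p : M × EuclideanSpace ℝ (Fin n) => F p.1 p.2)
      (univ ×ˢ Metric.ball 0 1)) {ε : ℝ} (hε : 0 < ε) (hε1 : ε < 1) (x : M) (k : ℕ) (φ : C(M, ℝ)) :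
    ∫ y, φ y ∂(visitFrequencyAt F ε x k) =
      ∫ s, average φ (fun j => randomOrbit (restrictFamily F ε) s j x) k
        ∂(seqMeasure (ballNoise n ε)) := by
  have := isProbabilityMeasure_ballNoise n hε
  have hG := continuous_restrictFamily hF hε1
  have hp := fun j => isProbabilityMeasure_orbitLaw hG (ballNoise n ε) j x
  simp only [visitFrequencyAt, map_iter_noiseSeq F hF hε hε1]
  rw [integral_smul_measure, integral_finsetSum_measure fun j _ => integrable_continuousMap φ _]
  simp only [average]
  rw [integral_const_mul, integral_finsetSum]
  · simp only [ENNReal.toReal_inv, ENNReal.toReal_natCast, smul_eq_mul]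
    congr 1
    refine Finset.sum_congr rfl fun j _ => ?_
    exact integral_map (continuous_randomOrbit_right hG j x).measurable.aemeasurable
      φ.continuous.aestronglyMeasurable
  · exact fun j _ => Integrable.of_bound
      (φ.continuous.comp (continuous_randomOrbit_right hG j x)).aestronglyMeasurable ‖φ‖
      (Eventually.of_forall fun _ => φ.norm_coe_le_norm _)

theorem integral_visitFrequency (F : M → EuclideanSpace ℝ (Fin n) → M)
    (hF : ContinuousOn (fun p : M × EuclideanSpace ℝ (Fin n) => F p.1 p.2)
      (univ ×ˢ Metric.ball 0 1)) {ε : ℝ} (hε : 0 < ε) (hε1 : ε < 1) (m : Measure M)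
    [IsFiniteMeasure m] (k : ℕ) (φ : C(M, ℝ)) :
    ∫ y, φ y ∂(visitFrequency m F ε k) =
      ∫ x, ∫ s, average φ (fun j => randomOrbit (restrictFamily F ε) s j x) k
        ∂(seqMeasure (ballNoise n ε)) ∂m := by
  have := isProbabilityMeasure_ballNoise n hε
  have hG := continuous_restrictFamily hF hε1
  have hmeas : ∀ j, Measurable fun p : M × (ℕ → NoiseBall n ε) =>
      randomOrbit (restrictFamily F ε) p.2 j p.1 := fun j => (continuous_randomOrbit hG j).measurable
  have hint : ∀ j, Integrable (fun p : M × (ℕ → NoiseBall n ε) =>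
      φ (randomOrbit (restrictFamily F ε) p.2 j p.1)) (m.prod (seqMeasure (ballNoise n ε))) :=
    fun j => Integrable.of_bound
      (φ.continuous.comp (continuous_randomOrbit hG j)).aestronglyMeasurable ‖φ‖
      (Eventually.of_forall fun _ => φ.norm_coe_le_norm _)
  simp only [visitFrequency, map_prod_iter_noiseSeq F hF hε hε1]
  rw [integral_smul_measure, integral_finsetSum_measure fun j _ => integrable_continuousMap φ _]
  simp only [average]
  rw [← integral_prod (fun p : M × (ℕ → NoiseBall n ε) => (k : ℝ)⁻¹ *
    ∑ j ∈ Finset.range k, φ (randomOrbit (restrictFamily F ε) p.2 j p.1))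
    ((integrable_finsetSum _ fun j _ => hint j).const_mul _),
    integral_const_mul, integral_finsetSum _ fun j _ => hint j]
  simp only [ENNReal.toReal_inv, ENNReal.toReal_natCast, smul_eq_mul]
  congr 1
  exact Finset.sum_congr rfl fun j _ => integral_map (hmeas j).aemeasurable
    φ.continuous.aestronglyMeasurable

end Restrict

/-! ### Orbits near an attractor -/

section Attractor

variable {M : Type*} [EMetricSpace M] [CompactSpace M] {n : ℕ}
  {F : M → EuclideanSpace ℝ (Fin n) → M} {f : M → M}

theorem exists_forall_iter_mem_of_mem_nhds
    (hF : ContinuousOn (fun p : M × EuclideanSpace ℝ (Fin n) => F p.1 p.2)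
      (univ ×ˢ Metric.ball 0 1)) (hF0 : ∀ x, F x 0 = f x) (k : ℕ) (y : M) {O : Set M}
    (hO : O ∈ 𝓝 (f^[k] y)) :
    ∃ V ∈ 𝓝 y, ∃ ε > 0, ∀ y' ∈ V, ∀ t ∈ perturbationSpace n ε, iter F t k y' ∈ O := by
  induction k generalizing O with
  | zero => exact ⟨O, hO, 1, one_pos, fun y' hy' t _ => hy'⟩
  | succ k ih =>
    rw [Function.iterate_succ_apply', ← hF0] at hO
    have hc : ContinuousAt (fun p : M × EuclideanSpace ℝ (Fin n) => F p.1 p.2) (f^[k] y, 0) :=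
      hF.continuousAt ((isOpen_univ.prod Metric.isOpen_ball).mem_nhds
        ⟨mem_univ _, Metric.mem_ball_self one_pos⟩)
    obtain ⟨W, hW, B, hB, hWB⟩ := mem_nhds_prod_iff.1 (hc hO)
    obtain ⟨δ, hδ, hδB⟩ := Metric.nhds_basis_closedBall.mem_iff.1 hB
    obtain ⟨V, hV, ε, hε, h⟩ := ih hW
    refine ⟨V, hV, min ε δ, lt_min hε hδ, fun y' hy' t ht => ?_⟩
    have h1 := h y' hy' t fun j => (ht j).trans (min_le_left _ _)
    have h2 : t k ∈ B := hδB (mem_closedBall_zero_iff.2 ((ht k).trans (min_le_right _ _)))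
    exact hWB (mk_mem_prod h1 h2)

/-- If the `k`-th iterate maps a compact set into an open set, then so do all `k`-th iterates at a
small noise level. -/
theorem exists_forall_iter_mem
    (hF : ContinuousOn (fun p : M × EuclideanSpace ℝ (Fin n) => F p.1 p.2)
      (univ ×ˢ Metric.ball 0 1)) (hF0 : ∀ x, F x 0 = f x) (k : ℕ) {A O : Set M}
    (hA : IsCompact A) (hO : IsOpen O) (h : ∀ y ∈ A, f^[k] y ∈ O) :
    ∃ ε₁ > 0, ∀ ε ≤ ε₁, ∀ y ∈ A, ∀ t ∈ perturbationSpace n ε, iter F t k y ∈ O := by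
  refine hA.induction_on (p := fun A => ∃ ε₁ > 0, ∀ ε ≤ ε₁, ∀ y ∈ A, ∀ t ∈ perturbationSpace n ε,
    iter F t k y ∈ O) ?_ ?_ ?_ ?_
  · exact ⟨1, one_pos, fun _ _ y hy => hy.elim⟩
  · rintro s t hst ⟨ε₁, hε₁, h1⟩
    exact ⟨ε₁, hε₁, fun ε hε y hy => h1 ε hε y (hst hy)⟩
  · rintro s t ⟨ε₁, hε₁, h1⟩ ⟨ε₂, hε₂, h2⟩
    refine ⟨min ε₁ ε₂, lt_min hε₁ hε₂, fun ε hε y hy => ?_⟩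
    rcases hy with hy | hy
    · exact h1 ε (hε.trans (min_le_left _ _)) y hy
    · exact h2 ε (hε.trans (min_le_right _ _)) y hy
  · intro y hy
    obtain ⟨V, hV, ε₁, hε₁, h1⟩ := exists_forall_iter_mem_of_mem_nhds hF hF0 k y
      (hO.mem_nhds (h y hy))
    exact ⟨V, mem_nhdsWithin_of_mem_nhds hV, ε₁, hε₁, fun ε hε y' hy' t ht =>
      h1 y' hy' t fun j => (ht j).trans hε⟩

/-- The images of the closed trapping region are compact and decrease to `Λ`, so they eventually
enter any neighbourhood of it. -/
theorem exists_forall_iterate_image_subset (hf : Continuous f) {Λ U : Set M}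
    (hU : f '' closure U ⊆ U) (hΛ : Λ = ⋂ k ≥ 1, f^[k] '' closure U) {O : Set M} (hO : IsOpen O)
    (hΛO : Λ ⊆ O) : ∃ k₀, ∀ k ≥ k₀, f^[k] '' closure U ⊆ O := by
  have hanti : Antitone fun k => f^[k] '' closure U := antitone_nat_of_succ_le fun k => by
    rw [Function.iterate_succ, image_comp]
    exact image_mono (hU.trans subset_closure)
  have hcomp : ∀ k, IsCompact (f^[k + 1] '' closure U) := fun k =>
    isClosed_closure.isCompact.image (hf.iterate _)
  obtain ⟨k, hk⟩ := exists_subset_nhds_of_isCompact' (V := fun k => f^[k + 1] '' closure U) (U := O)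
    (hanti.comp_monotone fun a b h => Nat.add_le_add_right h 1).directed_ge hcomp
    (fun k => (hcomp k).isClosed) fun x hx => hO.mem_nhds <| hΛO <| by
      rw [hΛ]
      refine mem_iInter₂.2 fun k hk => ?_
      obtain ⟨j, rfl⟩ := Nat.exists_eq_add_of_le' hk
      exact mem_iInter.1 hx j
  exact ⟨k + 1, fun j hj => (hanti hj).trans hk⟩

theorem measurableSet_basin [MeasurableSpace M] [BorelSpace M] (hf : Continuous f) (Λ : Set M) :
    MeasurableSet (basin f Λ) :=
  measurableSet_tendsto _ fun k => (Metric.continuous_infEDist.comp (hf.iterate k)).measurable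

theorem disjoint_basin {Λ Λ' : Set M} (hΛ : IsCompact Λ) (hΛ' : IsCompact Λ')
    (h : Disjoint Λ Λ') : Disjoint (basin f Λ) (basin f Λ') := by
  obtain ⟨δ, hδ, hdisj⟩ := h.exists_thickenings hΛ hΛ'.isClosed
  refine disjoint_left.2 fun x hx hx' => ?_
  have hδ' : 0 < ENNReal.ofReal δ := ENNReal.ofReal_pos.2 hδ
  have h1 : ∀ᶠ k in atTop, Metric.infEDist (f^[k] x) Λ < ENNReal.ofReal δ :=
    Tendsto.eventually_lt_const hδ' hx
  have h2 : ∀ᶠ k in atTop, Metric.infEDist (f^[k] x) Λ' < ENNReal.ofReal δ :=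
    Tendsto.eventually_lt_const hδ' hx'
  obtain ⟨k, hk, hk'⟩ := (h1.and h2).exists
  exact disjoint_left.1 hdisj hk hk'

theorem exists_iterate_mem_of_mem_basin {Λ O : Set M} (hΛ : IsCompact Λ) (hO : IsOpen O)
    (hΛO : Λ ⊆ O) {x : M} (hx : x ∈ basin f Λ) : ∃ k, f^[k] x ∈ O := by
  obtain ⟨δ, hδ, hsub⟩ := hΛ.exists_thickening_subset_open hO hΛO
  have h1 : ∀ᶠ k in atTop, Metric.infEDist (f^[k] x) Λ < ENNReal.ofReal δ :=
    Tendsto.eventually_lt_const (ENNReal.ofReal_pos.2 hδ) hx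
  obtain ⟨k, hk⟩ := h1.exists
  exact ⟨k, hsub hk⟩

theorem randomOrbit_restrictFamily_zero (hF0 : ∀ x, F x 0 = f x) {ε : ℝ} (hε : 0 ≤ ε) (j : ℕ)
    (x : M) : randomOrbit (restrictFamily F ε)
      (fun _ => ⟨0, Metric.mem_closedBall_self hε⟩) j x = f^[j] x := by
  induction j with
  | zero => rfl
  | succ j ih => rw [randomOrbit, ih, Function.iterate_succ_apply', ← hF0]; rfl

/-- At small noise levels, the time averages of almost all random orbits of a given point of the
basin of an attractor are described by the physical measure localized at the attractor. -/
theorem exists_forall_ae_timeAveragesTo [MeasurableSpace M] [BorelSpace M]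
    (hF : ContinuousOn (fun p : M × EuclideanSpace ℝ (Fin n) => F p.1 p.2)
      (univ ×ˢ Metric.ball 0 1)) (hF0 : ∀ x, F x 0 = f x) {ε₀ : ℝ} (hε₀ : ε₀ < 1)
    (hcover : ∀ ε ∈ Ioo 0 ε₀, ∃ K : ℕ, ∃ ξ : ℝ, 0 < ξ ∧ ∀ x : M, ∀ j ≥ K,
      Metric.eball (f^[j] x) (ENNReal.ofReal ξ) ⊆
        (fun t => iter F t j x) '' perturbationSpace n ε)
    (hf : Continuous f) {Λ : Set M} (hΛ : IsAttractor f Λ) {x : M} (hx : x ∈ basin f Λ) :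
    ∃ ε₁ > 0, ∀ ε ∈ Ioo 0 ε₀, ε ≤ ε₁ → ∀ ρ, IsLocalPhysicalMeasure F Λ ε ρ →
      ∀ᵐ t ∂(noiseSeq n ε), TimeAveragesTo F x t ρ := by
  obtain ⟨U, hUΛ, hfU, hΛU⟩ := hΛ.exists_trapping
  have hΛN : Λ ⊆ interior U := subset_interior_iff_mem_nhdsSet.2 hUΛ
  obtain ⟨k₀, hk₀⟩ := exists_iterate_mem_of_mem_basin hΛ.isCompact isOpen_interior hΛN hx
  obtain ⟨k₁, hk₁⟩ := exists_forall_iterate_image_subset hf hfU hΛU isOpen_interior hΛN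
  -- The extra iterate makes `q` positive, so that times can be divided by `q`.
  set q := k₁ + 1
  obtain ⟨ε₁, hε₁, h₁⟩ := exists_forall_iter_mem hF hF0 k₀ (isCompact_singleton (x := x))
    isOpen_interior (by simpa using hk₀)
  obtain ⟨ε₂, hε₂, h₂⟩ := exists_forall_iter_mem hF hF0 q
    (isClosed_closure.isCompact (s := closure U)) (isOpen_interior (s := U))
    fun y hy => hk₁ q (Nat.le_succ _) (mem_image_of_mem _ hy)
  refine ⟨min ε₁ ε₂, lt_min hε₁ hε₂, fun ε hε hεle ρ hρ => ?_⟩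
  obtain ⟨hρp, O, hO, -, hΛρ, hρO, hav⟩ := hρ
  have hε1 : ε < 1 := hε.2.trans hε₀
  have hG := continuous_restrictFamily hF hε1
  have hlp := isProbabilityMeasure_ballNoise n hε.1
  have hlo := isOpenPosMeasure_ballNoise n hε.1
  set G := restrictFamily F ε
  -- Whatever the noise, the orbit of `x` is back in the trapping region at all times `k₀ + l * q`.
  have hreturn : ∀ (l : ℕ) (s : ℕ → NoiseBall n ε), randomOrbit G s (k₀ + l * q) x ∈ interior U := by
    intro l
    induction l with
    | zero =>
      intro s
      rw [zero_mul, add_zero, ← iter_coeSeq]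
      exact h₁ ε (hεle.trans (min_le_left _ _)) x rfl _ (coeSeq_mem_perturbationSpace s)
    | succ l ih =>
      intro s
      rw [Nat.succ_mul, ← add_assoc, randomOrbit_add, ← iter_coeSeq]
      exact h₂ ε (hεle.trans (min_le_right _ _)) _ (subset_closure (interior_subset (ih s))) _
        (coeSeq_mem_perturbationSpace _)
  -- Once the noise is switched off at a reached point, the unperturbed orbit is in the trapping
  -- region by the next return time, at most `k₀ + q` steps later. This bound makes the union
  -- finite, hence closed, so the property passes to the closure.
  have hnear : closure (reachable G x) ⊆ ⋃ i ∈ Finset.range (k₀ + q + 1), f^[i] ⁻¹' closure U := by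
    refine closure_minimal ?_ (isClosed_biUnion_finset fun i _ =>
      isClosed_closure.preimage (hf.iterate i))
    rintro _ ⟨s, j, rfl⟩
    have hq : 0 < q := Nat.succ_pos _
    have hlt : j < (j / q + 1) * q := by
      rw [Nat.add_mul, one_mul, mul_comm]
      exact Nat.lt_mul_div_succ j hq |>.trans_eq (by rw [mul_add, mul_one])
    have hle : (j / q + 1) * q ≤ j + q := by
      rw [Nat.add_mul, one_mul]
      exact Nat.add_le_add_right (Nat.div_mul_le_self j q) q
    obtain ⟨i, hi⟩ := Nat.exists_eq_add_of_le (hlt.le.trans (Nat.le_add_left _ k₀))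
    refine mem_iUnion₂.2 ⟨i, Finset.mem_range.2 (by omega), ?_⟩
    have h3 := hreturn (j / q + 1)
      (fun a => if a < j then s a else ⟨0, Metric.mem_closedBall_self hε.1.le⟩)
    rw [hi, randomOrbit_add, randomOrbit_congr G (s' := s) fun a ha => if_pos ha] at h3
    simp only [add_lt_iff_neg_left, not_lt_zero, if_false] at h3
    rw [randomOrbit_restrictFamily_zero hF0 hε.1.le] at h3
    exact subset_closure (interior_subset h3)
  -- The unperturbed orbit of `y` comes within `ξ` of a point of `Λ` at a time that exceeds `K`. The
  -- perturbed iterates at that time cover the `ξ`-ball, so one of them is that point, which lies in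
  -- `supp ρ ⊆ O`.
  have hreach : ∀ y ∈ closure (reachable G x), (reachable G y ∩ O).Nonempty := by
    intro y hy
    obtain ⟨i, -, hi⟩ := mem_iUnion₂.1 (hnear hy)
    obtain ⟨K, ξ, hξ, hK⟩ := hcover ε hε
    have hto : IsOpen {z | Metric.infEDist z Λ < ENNReal.ofReal ξ} :=
      isOpen_lt Metric.continuous_infEDist continuous_const
    obtain ⟨k₂, hk₂⟩ := exists_forall_iterate_image_subset hf hfU hΛU hto fun z hz => by
      rw [mem_ofPred_eq, Metric.infEDist_zero_of_mem hz]
      exact ENNReal.ofReal_pos.2 hξ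
    have h3 : Metric.infEDist (f^[max k₂ K] (f^[i] y)) Λ < ENNReal.ofReal ξ :=
      hk₂ (max k₂ K) (le_max_left _ _) (mem_image_of_mem _ hi)
    obtain ⟨w, hw, hdist⟩ := Metric.infEDist_lt_iff.1 h3
    rw [← Function.iterate_add_apply, edist_comm] at hdist
    obtain ⟨t, ht, rfl⟩ := hK y (max k₂ K + i) ((le_max_right _ _).trans (Nat.le_add_right _ _)) hdist
    obtain ⟨s, rfl⟩ := exists_coeSeq_eq ht
    exact ⟨_, ⟨s, _, (iter_coeSeq F s _ y).symm⟩, hρO (hΛρ hw)⟩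
  rw [ae_timeAveragesTo_iff F hε.1]
  have hself : x ∈ reachable G x := ⟨fun _ => ⟨0, Metric.mem_closedBall_self hε.1.le⟩, 0, rfl⟩
  have hhit := ae_exists_randomOrbit_mem hG (ballNoise n ε) hO isClosed_closure
    ((forwardInvariant_reachable G x).closure hG) hreach (subset_closure hself)
  have htrans := ae_all_iff.2 fun j => ae_hasTimeAverages_of_randomOrbit_mem hG (ballNoise n ε) ρ
    hO.measurableSet (fun z hz => (ae_timeAveragesTo_iff F hε.1 z ρ).1 (hav z hz)) j x
  filter_upwards [hhit, htrans] with s ⟨j, hj⟩ hs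
  exact hs j hj

/-- Test on the constant `1`: the default value of `localPhysicalMeasure` has mass zero, whereas the
masses tend to one. -/
theorem IsStochasticallyStable.eventually_isLocalPhysicalMeasure [MeasurableSpace M] {Λ : Set M}
    {μ : Measure M} (h : IsStochasticallyStable f F Λ μ) :
    ∀ᶠ ε in 𝓝[>] (0 : ℝ), IsLocalPhysicalMeasure F Λ ε (localPhysicalMeasure F Λ ε) := by
  have := h.isProbabilityMeasure
  have h1 := h.tendsto 1
  simp only [ContinuousMap.one_apply, integral_const, probReal_univ, smul_eq_mul, mul_one] at h1
  filter_upwards [h1.eventually_const_lt zero_lt_one] with ε hε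
  by_cases hex : ∃ μ, IsLocalPhysicalMeasure F Λ ε μ
  · rw [localPhysicalMeasure, dif_pos hex]
    exact hex.choose_spec
  · rw [localPhysicalMeasure, dif_neg hex] at hε
    simp at hε

end Attractor

/-! ### Mean sojourn times -/

section Sojourn

variable {M : Type*} [EMetricSpace M] [CompactSpace M] [MeasurableSpace M] [BorelSpace M] {n : ℕ}
  {F : M → EuclideanSpace ℝ (Fin n) → M}

theorem isMeanSojournTimeAt_of_ae_timeAveragesTo
    (hF : ContinuousOn (fun p : M × EuclideanSpace ℝ (Fin n) => F p.1 p.2)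
      (univ ×ˢ Metric.ball 0 1)) {ε : ℝ} (hε : 0 < ε) (hε1 : ε < 1) {x : M} {ρ : Measure M}
    [IsProbabilityMeasure ρ] (h : ∀ᵐ t ∂(noiseSeq n ε), TimeAveragesTo F x t ρ) :
    IsMeanSojournTimeAt F ε x ρ := by
  have := isProbabilityMeasure_ballNoise n hε
  refine ⟨inferInstance, fun φ => ?_⟩
  rw [ae_timeAveragesTo_iff F hε] at h
  have h1 := tendsto_integral_average (continuous_restrictFamily hF hε1) (ballNoise n ε) φ x
    (h.mono fun s hs => hs φ)
  simp only [integral_visitFrequencyAt F hF hε hε1]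
  simpa using h1

/-- The final clause, which writes the integral against the global measure as an integral over
initial points of the pointwise limits `ψ`, is what dominated convergence needs as `ε` tends to
zero. -/
theorem exists_isMeanSojournTime
    (hF : ContinuousOn (fun p : M × EuclideanSpace ℝ (Fin n) => F p.1 p.2)
      (univ ×ˢ Metric.ball 0 1)) {ε : ℝ} (hε : 0 < ε) (hε1 : ε < 1) {m : Measure M}
    [IsProbabilityMeasure m] {K : ℕ} {y : M → M} {ξ : ℝ} (hξ : 0 < ξ)
    (hcover : ∀ x, Metric.eball (y x) (ENNReal.ofReal ξ) ⊆
      (fun t => iter F t K x) '' perturbationSpace n ε)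
    (hac : ∀ x, (noiseSeq n ε).map (fun t => iter F t K x) ≪ m) :
    ∃ μ : Measure M, (IsMeanSojournTime m F ε μ ∧
      ∃ (l : ℕ) (ν : Fin l → Measure M) (β : Fin l → ℝ≥0),
        Function.Injective ν ∧ Set.range ν = {ρ | IsPhysicalMeasure m F ε ρ} ∧
        ∑ k, β k = 1 ∧ μ = ∑ k, β k • ν k) ∧
      ∀ φ : C(M, ℝ), ∃ ψ : M → ℝ, Measurable ψ ∧ (∀ x, |ψ x| ≤ ‖φ‖) ∧
        (∀ x, Tendsto (fun k => ∫ y, φ y ∂(visitFrequencyAt F ε x k)) atTop (𝓝 (ψ x))) ∧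
        ∫ y, φ y ∂μ = ∫ x, ψ x ∂m := by
  have hlp := isProbabilityMeasure_ballNoise n hε
  have hlo := isOpenPosMeasure_ballNoise n hε
  have hG := continuous_restrictFamily hF hε1
  obtain ⟨l, ν, p, hνp, hνinj, hpm, hp0, hp1, hconv, hpos, huniq⟩ :=
    exists_physical_decomposition hG (ballNoise n ε) (m := m) (K := K)
      (fun x => map_iter_noiseSeq F hF hε hε1 K x ▸ hac x) (ENNReal.ofReal_pos.2 hξ)
      fun x => ⟨y x, fun z hz => by
        obtain ⟨t, ht, rfl⟩ := hcover x hz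
        obtain ⟨s, rfl⟩ := exists_coeSeq_eq ht
        exact ⟨s, K, (iter_coeSeq F s K x).symm⟩⟩
  have hp_le : ∀ k x, p k x ≤ 1 := fun k x =>
    (Finset.single_le_sum (fun i _ => hp0 i x) (Finset.mem_univ k)).trans_eq (hp1 x)
  have hpi : ∀ k, Integrable (p k) m := fun k =>
    Integrable.of_bound (hpm k).aestronglyMeasurable 1 (Eventually.of_forall fun x => by
      rw [Real.norm_eq_abs, abs_of_nonneg (hp0 k x)]; exact hp_le k x)
  -- The weight is the probability of ending in the `k`-th minimal set when the initial point is
  -- distributed according to `m`.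
  set β : Fin l → ℝ≥0 := fun k => ⟨∫ x, p k x ∂m, integral_nonneg fun x => hp0 k x⟩
  have hβ : ∑ k, β k = 1 := by
    rw [← NNReal.coe_inj, NNReal.coe_sum, NNReal.coe_one]
    change ∑ k, ∫ x, p k x ∂m = 1
    rw [← integral_finsetSum _ fun k _ => hpi k]
    simp [hp1]
  set μ : Measure M := ∑ k, β k • ν k
  have hμp : IsProbabilityMeasure μ := ⟨by
    simp only [μ, Measure.finsetSum_apply, Measure.smul_apply, measure_univ]
    have : ∑ k, β k • (1 : ℝ≥0∞) = ((∑ k, β k : ℝ≥0) : ℝ≥0∞) := by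
      rw [ENNReal.ofNNReal_finsetSum]
      exact Finset.sum_congr rfl fun k _ => by simp [ENNReal.smul_def]
    rw [this, hβ, ENNReal.coe_one]⟩
  have hμint : ∀ φ : C(M, ℝ), ∫ y, φ y ∂μ = ∫ x, ∑ k, p k x * ∫ y, φ y ∂(ν k) ∂m := fun φ => by
    simp only [μ]
    rw [integral_finsetSum_measure fun k _ => integrable_continuousMap φ _,
      integral_finsetSum _ fun k _ => (hpi k).mul_const _]
    refine Finset.sum_congr rfl fun k _ => ?_
    rw [integral_mul_const, integral_smul_nnreal_measure]
    rfl
  have hψ : ∀ φ : C(M, ℝ), ∀ x, |∑ k, p k x * ∫ y, φ y ∂(ν k)| ≤ ‖φ‖ := fun φ x => by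
    refine le_of_tendsto (hconv x φ).abs (Eventually.of_forall fun j => ?_)
    have := norm_integral_le_of_norm_le_const (μ := seqMeasure (ballNoise n ε))
      (f := fun s => average φ (fun j => randomOrbit (restrictFamily F ε) s j x) j)
      (Eventually.of_forall fun s => abs_average_le φ _ j)
    simpa using this
  refine ⟨μ, ⟨⟨hμp, fun φ => ?_⟩, l, ν, β, hνinj, ?_, hβ, rfl⟩, fun φ =>
    ⟨fun x => ∑ k, p k x * ∫ y, φ y ∂(ν k), ?_, hψ φ, fun x => ?_, hμint φ⟩⟩
  · simp only [integral_visitFrequency F hF hε hε1 m, hμint]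
    refine tendsto_integral_of_dominated_convergence (fun _ => ‖φ‖) (fun k => ?_)
      (integrable_const _) (fun k => Eventually.of_forall fun x => ?_)
      (Eventually.of_forall fun x => hconv x φ)
    · refine Continuous.aestronglyMeasurable ?_
      refine continuous_of_dominated (bound := fun _ => ‖φ‖)
        (fun x => (integrable_average_randomOrbit hG (ballNoise n ε) φ x k).aestronglyMeasurable)
        (fun x => Eventually.of_forall fun s => abs_average_le φ _ k) (integrable_const _)
        (Eventually.of_forall fun s => ?_)
      exact continuous_const.mul (continuous_finsetSum _ fun j _ =>
        φ.continuous.comp (continuous_randomOrbit_left hG j s))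
    · have := norm_integral_le_of_norm_le_const (μ := seqMeasure (ballNoise n ε))
        (f := fun s => average φ (fun j => randomOrbit (restrictFamily F ε) s j x) k)
        (Eventually.of_forall fun s => abs_average_le φ _ k)
      simpa using this
  · ext ρ
    constructor
    · rintro ⟨k, rfl⟩
      refine ⟨hνp k, ?_⟩
      simp only [ae_timeAveragesTo_iff F hε]
      exact hpos k
    · rintro ⟨hρp, hρ⟩
      simp only [ae_timeAveragesTo_iff F hε] at hρ
      obtain ⟨x, hx⟩ := nonempty_of_measure_ne_zero hρ.ne'
      obtain ⟨k, rfl⟩ := huniq ρ x hρp hx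
      exact mem_range_self k
  · exact Finset.measurable_sum _ fun k _ => (hpm k).mul_const _
  · simp only [integral_visitFrequencyAt F hF hε hε1]
    exact hconv x φ

end Sojourn

/-! ### Countable mixtures and the total mass of the normalized volume -/

section Weights

variable {M : Type*} [TopologicalSpace M] [CompactSpace M] [TopologicalSpace.MetrizableSpace M]
  [MeasurableSpace M] [BorelSpace M]

/-- The integral against a countable mixture, as an integral over the mixing space. -/
theorem integral_eq_integral_sum_measure {Ω ι : Type*} [MeasurableSpace Ω] [Countable ι]
    {m : Measure Ω} [IsFiniteMeasure m] {S : ι → Set Ω} (hS : ∀ i, MeasurableSet (S i))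
    (hdisj : Pairwise fun i j => Disjoint (S i) (S j)) (hcover : ∀ᵐ x ∂m, x ∈ ⋃ i, S i)
    {μ : ι → Measure M} (hμ : ∀ i, IsProbabilityMeasure (μ i)) (φ : C(M, ℝ)) {g : Ω → ℝ}
    (hg : Integrable g m) (hgS : ∀ i, ∀ x ∈ S i, g x = ∫ y, φ y ∂(μ i)) :
    ∫ x, g x ∂m = ∫ y, φ y ∂(Measure.sum fun i => m (S i) • μ i) := by
  have hfin : IsFiniteMeasure (Measure.sum fun i => m (S i) • μ i) := ⟨by
    rw [Measure.sum_apply _ MeasurableSet.univ]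
    simp only [Measure.smul_apply, measure_univ, smul_eq_mul, mul_one]
    rw [← measure_iUnion hdisj hS]
    exact measure_lt_top _ _⟩
  have h1 := hasSum_integral_measure (integrable_continuousMap φ (Measure.sum fun i => m (S i) • μ i))
  have h2 := hasSum_integral_iUnion hS hdisj hg.integrableOn
  rw [Measure.restrict_eq_self_of_ae_mem hcover] at h2
  have h3 : (fun i => ∫ x in S i, g x ∂m) = fun i => ∫ y, φ y ∂(m (S i) • μ i) := funext fun i => by
    rw [setIntegral_congr_fun (hS i) (hgS i), setIntegral_const, integral_smul_measure]
    rfl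
  exact h2.unique (h3 ▸ h1)

end Weights

/-- If the total volume were zero or infinite, the conventions for the inverse would make the
normalized volume zero. So finiteness need not be proved from the geometry. -/
theorem isProbabilityMeasure_normalizedVolume {d : ℕ} {M : Type*} [TopologicalSpace M]
    [ChartedSpace (EuclideanSpace ℝ (Fin d)) M]
    [RiemannianBundle (fun x : M => TangentSpace (𝓡 d) x)] [MeasurableSpace M]
    (h : normalizedVolume d M ≠ 0) : IsProbabilityMeasure (normalizedVolume d M) := by
  have h0 : riemannianVolume d M univ ≠ 0 := fun h0 => h <| by
    rw [normalizedVolume, Measure.measure_univ_eq_zero.1 h0, smul_zero]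
  have htop : riemannianVolume d M univ ≠ ⊤ := fun htop => h <| by
    rw [normalizedVolume, htop, ENNReal.inv_top, zero_smul]
  exact ⟨by
    rw [normalizedVolume, Measure.smul_apply, smul_eq_mul, ENNReal.inv_mul_cancel h0 htop]⟩

end RandomPerturbation

theorem theoremA
    -- a nonempty compact smooth Riemannian manifold without boundary, of dimension `d`
    (d : ℕ) {M : Type*} [EMetricSpace M] [CompactSpace M] [Nonempty M]
    [ChartedSpace (EuclideanSpace ℝ (Fin d)) M] [IsManifold (𝓡 d) ∞ M]
    [RiemannianBundle (fun x : M => TangentSpace (𝓡 d) x)]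
    [IsContMDiffRiemannianBundle (𝓡 d) ∞ (EuclideanSpace ℝ (Fin d))
      (fun x : M => TangentSpace (𝓡 d) x)]
    [IsRiemannianManifold (𝓡 d) M]
    [MeasurableSpace M] [BorelSpace M]
    -- a diffeomorphism with a physical random perturbation
    (f : M ≃ₘ^1⟮𝓡 d, 𝓡 d⟯ M) {n : ℕ} (F : M → EuclideanSpace ℝ (Fin n) → M) (ε₀ : ℝ)
    (hF : IsPhysicalRandomPerturbation d f F ε₀)
    -- at most countably many disjoint stochastically stable attractors
    {ι : Type*} [Countable ι] (Λ : ι → Set M) (μ : ι → Measure M)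
    (hdisj : Pairwise (fun i j => Disjoint (Λ i) (Λ j)))
    (hattr : ∀ i, IsAttractor f (Λ i))
    (hbasin : ∀ᵐ x ∂(normalizedVolume d M), x ∈ ⋃ i, basin f (Λ i))
    (hstable : ∀ i, IsStochasticallyStable f F (Λ i) (μ i)) :
    (∀ᵐ x ∂(normalizedVolume d M), ∃ εx : ℝ, 0 < εx ∧ ∃ i : ι, ∃ μx : ℝ → Measure M,
      (∀ ε ∈ Set.Ioo 0 εx,
        IsMeanSojournTimeAt F ε x (μx ε) ∧
        IsLocalPhysicalMeasure F (Λ i) ε (localPhysicalMeasure F (Λ i) ε) ∧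
        μx ε = localPhysicalMeasure F (Λ i) ε) ∧
      WeakStarTendsto μx (𝓝[>] (0 : ℝ)) (μ i)) ∧
    (∃ μs : ℝ → Measure M,
      (∀ ε ∈ Set.Ioo 0 ε₀,
        IsMeanSojournTime (normalizedVolume d M) F ε (μs ε) ∧
        ∃ (l : ℕ) (ν : Fin l → Measure M) (β : Fin l → ℝ≥0),
          Function.Injective ν ∧
          Set.range ν = {ρ | IsPhysicalMeasure (normalizedVolume d M) F ε ρ} ∧
          ∑ k, β k = 1 ∧
          μs ε = ∑ k, β k • ν k) ∧
      WeakStarTendsto μs (𝓝[>] (0 : ℝ))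
        (Measure.sum (fun i => normalizedVolume d M (basin f (Λ i)) • μ i))) := by
  have hFc : ContinuousOn (fun p : M × EuclideanSpace ℝ (Fin n) => F p.1 p.2)
      (Set.univ ×ˢ Metric.ball 0 1) := hF.contMDiffOn.continuousOn
  have hf : Continuous f := f.continuous
  -- The normalized volume is not zero, since a probability law of a random iterate is absolutely
  -- continuous with respect to it.
  have hprob : IsProbabilityMeasure (normalizedVolume d M) := by
    have hε : ε₀ / 2 ∈ Set.Ioo 0 ε₀ := ⟨half_pos hF.pos, half_lt_self hF.pos⟩
    obtain ⟨K, ξ, -, -, hac⟩ := hF.cover_and_ac _ hε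
    refine isProbabilityMeasure_normalizedVolume fun h0 => ?_
    have h1 := hac (Classical.arbitrary M) K le_rfl
    have := isProbabilityMeasure_ballNoise n hε.1
    have := isProbabilityMeasure_orbitLaw (continuous_restrictFamily hFc (hε.2.trans hF.lt_one))
      (ballNoise n (ε₀ / 2)) K (Classical.arbitrary M)
    rw [map_iter_noiseSeq F hFc hε.1 (hε.2.trans hF.lt_one), h0,
      Measure.absolutelyContinuous_zero_iff] at h1
    exact IsProbabilityMeasure.ne_zero _ h1
  have hcover : ∀ ε ∈ Set.Ioo 0 ε₀, ∃ K : ℕ, ∃ ξ : ℝ, 0 < ξ ∧ ∀ x : M, ∀ j ≥ K,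
      Metric.eball (f^[j] x) (ENNReal.ofReal ξ) ⊆
        (fun t => iter F t j x) '' perturbationSpace n ε := fun ε hε => by
    obtain ⟨K, ξ, hξ, h, -⟩ := hF.cover_and_ac ε hε
    exact ⟨K, ξ, hξ, h⟩
  have hlocal : ∀ i, ∀ x ∈ basin f (Λ i), ∃ εx : ℝ, 0 < εx ∧ ∀ ε ∈ Set.Ioo 0 εx,
      IsMeanSojournTimeAt F ε x (localPhysicalMeasure F (Λ i) ε) ∧
      IsLocalPhysicalMeasure F (Λ i) ε (localPhysicalMeasure F (Λ i) ε) := by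
    intro i x hx
    obtain ⟨ε₁, hε₁, h1⟩ :=
      exists_forall_ae_timeAveragesTo hFc hF.zero hF.lt_one hcover hf (hattr i) hx
    obtain ⟨ε₂, hε₂, h2⟩ := mem_nhdsGT_iff_exists_Ioo_subset.1
      (hstable i).eventually_isLocalPhysicalMeasure
    refine ⟨min ε₀ (min ε₁ ε₂), lt_min hF.pos (lt_min hε₁ hε₂), fun ε hε => ?_⟩
    have hε0 : ε < ε₀ := hε.2.trans_le (min_le_left _ _)
    have hε1 : ε ≤ ε₁ := hε.2.le.trans ((min_le_right _ _).trans (min_le_left _ _))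
    have hε2 : ε < ε₂ := hε.2.trans_le ((min_le_right _ _).trans (min_le_right _ _))
    have hloc := h2 ⟨hε.1, hε2⟩
    have := hloc.1
    exact ⟨isMeanSojournTimeAt_of_ae_timeAveragesTo hFc hε.1 (hε0.trans hF.lt_one)
      (h1 ε ⟨hε.1, hε0⟩ hε1 _ hloc), hloc⟩
  have hglobal : ∀ ε ∈ Set.Ioo 0 ε₀, ∃ ρ : Measure M,
      (IsMeanSojournTime (normalizedVolume d M) F ε ρ ∧
        ∃ (l : ℕ) (ν : Fin l → Measure M) (β : Fin l → ℝ≥0),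
          Function.Injective ν ∧
          Set.range ν = {ρ | IsPhysicalMeasure (normalizedVolume d M) F ε ρ} ∧
          ∑ k, β k = 1 ∧ ρ = ∑ k, β k • ν k) ∧
      ∀ φ : C(M, ℝ), ∃ ψ : M → ℝ, Measurable ψ ∧ (∀ x, |ψ x| ≤ ‖φ‖) ∧
        (∀ x, Tendsto (fun k => ∫ y, φ y ∂(visitFrequencyAt F ε x k)) atTop (𝓝 (ψ x))) ∧
        ∫ y, φ y ∂ρ = ∫ x, ψ x ∂(normalizedVolume d M) := fun ε hε => by
    obtain ⟨K, ξ, hξ, h, hac⟩ := hF.cover_and_ac ε hε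
    exact exists_isMeanSojournTime hFc hε.1 (hε.2.trans hF.lt_one) hξ (fun x => h x K le_rfl)
      fun x => hac x K le_rfl
  refine ⟨?_, ?_⟩
  · filter_upwards [hbasin] with x hx
    obtain ⟨i, hi⟩ := Set.mem_iUnion.1 hx
    obtain ⟨εx, hεx, h⟩ := hlocal i x hi
    exact ⟨εx, hεx, i, fun ε => localPhysicalMeasure F (Λ i) ε,
      fun ε hε => ⟨(h ε hε).1, (h ε hε).2, rfl⟩, (hstable i).tendsto⟩
  · choose! μs hμs hψ using hglobal
    refine ⟨μs, hμs, fun φ => ?_⟩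
    choose! ψ hψm hψb hψlim hψint using fun ε hε => hψ ε hε φ
    have hsmall : ∀ᶠ ε in 𝓝[>] (0 : ℝ), ε ∈ Set.Ioo 0 ε₀ := Ioo_mem_nhdsGT hF.pos
    -- At small noise `ψ ε x` is the integral against the local physical measure, by uniqueness of
    -- limits, so stochastic stability applies at each point of the basin.
    have hconv : ∀ i, ∀ x ∈ basin f (Λ i),
        Tendsto (fun ε => ψ ε x) (𝓝[>] (0 : ℝ)) (𝓝 (∫ y, φ y ∂(μ i))) := fun i x hx => by
      obtain ⟨εx, hεx, h⟩ := hlocal i x hx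
      refine ((hstable i).tendsto φ).congr' ?_
      filter_upwards [hsmall, Ioo_mem_nhdsGT hεx] with ε hε hε'
      exact tendsto_nhds_unique ((h ε hε').1.2 φ) (hψlim ε hε x)
    classical
    set g : M → ℝ := fun x =>
      if h : ∃ i, x ∈ basin f (Λ i) then ∫ y, φ y ∂(μ h.choose) else 0
    have hdisj' : Pairwise fun i j => Disjoint (basin f (Λ i)) (basin f (Λ j)) := fun i j hij =>
      disjoint_basin (hattr i).isCompact (hattr j).isCompact (hdisj hij)
    have hg : ∀ i, ∀ x ∈ basin f (Λ i), g x = ∫ y, φ y ∂(μ i) := fun i x hx => by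
      have hex : ∃ i, x ∈ basin f (Λ i) := ⟨i, hx⟩
      have hi : hex.choose = i := by
        by_contra hne
        exact Set.disjoint_left.1 (hdisj' hne) hex.choose_spec hx
      simp only [g, dif_pos hex, hi]
    have hlim : ∀ᵐ x ∂(normalizedVolume d M),
        Tendsto (fun ε => ψ ε x) (𝓝[>] (0 : ℝ)) (𝓝 (g x)) := by
      filter_upwards [hbasin] with x hx
      obtain ⟨i, hi⟩ := Set.mem_iUnion.1 hx
      rw [hg i x hi]
      exact hconv i x hi
    have hgb : ∀ᵐ x ∂(normalizedVolume d M), ‖g x‖ ≤ ‖φ‖ := by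
      filter_upwards [hlim] with x hx
      refine le_of_tendsto hx.norm ?_
      filter_upwards [hsmall] with ε hε using hψb ε hε x
    -- Measurability passes to limits of sequences, so a sequence of noise levels tending to zero is
    -- chosen.
    have hgm : AEStronglyMeasurable g (normalizedVolume d M) := by
      obtain ⟨u, hu⟩ := (𝓝[>] (0 : ℝ)).exists_seq_tendsto
      obtain ⟨N, hN⟩ := eventually_atTop.1 (hu.eventually hsmall)
      refine aestronglyMeasurable_of_tendsto_ae atTop
        (f := fun k => ψ (u (k + N))) (fun k => ?_) ?_
      · exact (hψm _ (hN _ (Nat.le_add_left _ _))).aestronglyMeasurable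
      · filter_upwards [hlim] with x hx
        exact hx.comp (hu.comp (tendsto_add_atTop_nat N))
    -- The integral against the mixture becomes the integral of `g`, the pointwise limit of `ψ ε`,
    -- and dominated convergence finishes.
    rw [← integral_eq_integral_sum_measure (fun i => measurableSet_basin hf (Λ i)) hdisj' hbasin
      (fun i => (hstable i).isProbabilityMeasure) φ (Integrable.of_bound hgm ‖φ‖ hgb) hg]
    refine Tendsto.congr' ?_ (tendsto_integral_filter_of_dominated_convergence (fun _ => ‖φ‖) ?_ ?_
      (integrable_const _) hlim)
    · filter_upwards [hsmall] with ε hε using (hψint ε hε).symm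
    · filter_upwards [hsmall] with ε hε using (hψm ε hε).aestronglyMeasurable
    · filter_upwards [hsmall] with ε hε using Eventually.of_forall (hψb ε hε)
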